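/- For $k\ge 0$ let $g^{(k)}(u)=\sum_{n\ge 1}\frac{e^{2\pi i n u}}{(2\pi i n)^k}$, $u\in\mathbb R/\mathbb Z$. Given a finite directed graph with vertex set $V$ and edge set $E$, each edge $e$ from $s(e)$ to $t(e)$ carrying an order $k_e\in\{0,1,2,\dots\}$, its value is $$\int_{(\mathbb R/\mathbb Z)^V}\ \prod_{e\in E}(2\pi i)^{k_e}\,g^{(k_e)}\big(u_{s(e)}-u_{t(e)}\big)\prod_{v\in V} du_v ,$$ understood as the limit $r\to 1^-$ of the same integral with $g^{(k)}(u)$ replaced by $\sum_{n\ge1} r^n e^{2\pi i n u}/(2\pi i n)^k$; the graph *converges* if this limit exists and is finite. For non-empty finite sequences $a,b,c$ of non-negative integers, the *peacock diagram* $(a_1,\dots,a_m|b_1,\dots,b_n|c_1,\dots,c_k)$ has a root vertex, a top vertex, a stem (a directed path from the root to the top whose successive edges have orders $a_1,\dots,a_m$), two feathers (directed paths from the top to the root whose successive edges have orders $b_1,\dots,b_n$ and $c_1,\dots,c_k$), and from every inner vertex of these three paths an edge of order $0$ to the root. Let $Z(a|b|c)$ be its value. For a finite sequence $k=(k_1,\dots,k_m)$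 put $\zeta(k_1,\dots,k_m)=\sum_{n_1>\dots>n_m>0} n_1^{-k_1}\cdots n_m^{-k_m}$. Call $k$ *positive* if all its entries are $\ge 1$, and *admissible* if it is moreover non-empty with $k_1\ge 2$. Then: 1. $Z(a|b|c)=Z(a|c|b)$ (for non-empty $a,b,c$; one side converges iff the other does). 2. For $b_1,c_1\ge 1$ and arbitrary, possibly empty, remaining entries, $$\begin{aligned}Z(a_1,\dots,a_m,0|b_1,b_2,\dots|c_1,c_2,\dots)={}&\sum_{\nu=1}^{b_1}\binom{b_1+c_1-\nu-1}{c_1-1}Z(a_1,\dots,a_m,b_1+c_1-\nu|\nu,b_2,\dots|0,c_2,\dots)\\&+\sum_{\nu=1}^{c_1}\binom{b_1+c_1-\nu-1}{b_1-1}Z(a_1,\dots,a_m,b_1+c_1-\nu|0,b_2,\dots|\nu,c_2,\dots),\end{aligned}$$ whenever the left side converges, which happens iff all diagrams on the right converge. 3. For non-empty $a,b,c$: $Z(a|0,b|c)=Z(a|c|0,b)=Z(a,0|b|c)$; if one of these diagrams converges, so do the others. 4. For non-empty $a,b$: the diagram $(0|a|b)$ converges iff the series for $\zeta(a)$ and $\zeta(b)$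 both converge, and then $\zeta(a)\,\zeta(b)=Z(0|a|b)$. 5. For non-empty $a,b$: the diagrams $(a|0|b)$ and $(a|b|0)$ converge iff the series $\zeta(a,b)=\zeta(a_1,\dots,a_m,b_1,\dots,b_n)$ converges, and then $Z(a|0|b)=Z(a|b|0)=\zeta(a,b)$. 6. Define finite multisets $\mathcal E(d;b;c)$ of sequences, for finite sequences $d,b,c$, by $\mathcal E(d;\emptyset;c)=\{(d,c)\}$, $\mathcal E(d;b;\emptyset)=\{(d,b)\}$ and, for $b=(b_1,b')$, $c=(c_1,c')$, $$\mathcal E(d;b;c)=\sum_{\nu=1}^{b_1}\binom{b_1+c_1-\nu-1}{c_1-1}\mathcal E\big(d,b_1+c_1-\nu;\,\nu,b';\,c'\big)+\sum_{\nu=1}^{c_1}\binom{b_1+c_1-\nu-1}{b_1-1}\mathcal E\big(d,b_1+c_1-\nu;\,b';\,\nu,c'\big).$$ If $b,c$ are non-empty and positive and $(d,0|b|c)$ converges, then $\zeta(s)$ converges for every $s\in\mathcal E(d;b;c)$, and $Z(d,0|b|c)=\sum_{s\in\mathcal E(d;b;c)}\zeta(s)$. 7. The series $\zeta(a)$ converges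 for every admissible $a$. For admissible $a=(a_1,\dots,a_m)$ and $b=(b_1,\dots,b_n)$, $$\zeta(a_1,\dots,a_m)\,\zeta(b_1,\dots,b_n)=\sum_{s\in\mathcal E(\emptyset;a;b)}\zeta(s),$$ and every $s\in\mathcal E(\emptyset;a;b)$ is admissible, has length $m+n$, and has weight $\sum_i a_i+\sum_j b_j$. 8. This is the weight-length shuffle relation: for positive $a,b$, encoding $(k_1,\dots,k_m)$ by the word $x_0^{k_1-1}x_1\cdots x_0^{k_m-1}x_1$, the multiset of words encoding the elements of $\mathcal E(\emptyset;a;b)$ is the shuffle product (multiset of all interleavings) of the words encoding $a$ and $b$. -/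

import Mathlib

open Filter Topology

/-- A Feynman diagram of the one-dimensional model: finitely many propagators (edges) `e`, directed
from the vertex `src e` to the vertex `tgt e`, each carrying an order `order e = 0, 1, 2, …`. -/
structure FeynmanDiagram (V E : Type) where
  src : E → V
  tgt : E → V
  order : E → ℕ

/-- The propagator `g^{(k)}(u) = ∑_{n ≥ 1} e^{2πinu} / (2πin)^k` on the unit circle with the
convergence factor `r ^ n`. For `k = 0` the limit `r → 1⁻` is the distribution
`(δ(u) - 1 + i cot(πu)) / 2`, with the cotangent taken as a principal value. -/
noncomputable def propagator (r : ℝ) (k : ℕ) (u : UnitAddCircle) : ℂ :=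
  ∑' n : ℕ, (r : ℂ) ^ (n + 1) * fourier ((n : ℤ) + 1) u
    / (2 * (Real.pi : ℂ) * Complex.I * ((n : ℂ) + 1)) ^ k

namespace FeynmanDiagram

variable {V E : Type} [Fintype V] [Fintype E]

/-- The Feynman integral: every propagator contributes `(2πi)^k g^{(k)}(u_src - u_tgt)`
(the coupling constants are set to `1`), and all vertex positions are integrated over the
unit circle (of total length `1`). -/
noncomputable def amplitude (D : FeynmanDiagram V E) (r : ℝ) : ℂ :=
  ∫ u : V → UnitAddCircle,
    ∏ e : E, (2 * (Real.pi : ℂ) * Complex.I) ^ D.order e *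
      propagator r (D.order e) (u (D.src e) - u (D.tgt e))

/-- The Feynman integral has a finite value when the convergence factors are removed. -/
def Converges (D : FeynmanDiagram V E) : Prop :=
  ∃ z : ℂ, Tendsto D.amplitude (𝓝[<] 1) (𝓝 z)

/-- The value of the diagram (meaningful only when `D.Converges`). -/
noncomputable def value (D : FeynmanDiagram V E) : ℂ :=
  limUnder (𝓝[<] 1) D.amplitude

end FeynmanDiagram

/-- Vertices of the peacock diagram with `m + 1`, `n + 1`, `k + 1` labelled propagators on its
stem, left feather and right feather. -/
inductive PeacockVertex (m n k : ℕ)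
  | root
  | top
  | stem (i : Fin m)
  | left (i : Fin n)
  | right (i : Fin k)
  deriving Fintype

/-- Propagators of the peacock diagram: the labelled ones along the stem and the two feathers, and
an unlabelled one, of order `0`, for every inner vertex of these three chains. -/
inductive PeacockEdge (m n k : ℕ)
  | stem (i : Fin (m + 1))
  | left (i : Fin (n + 1))
  | right (i : Fin (k + 1))
  | stemZero (i : Fin m)
  | leftZero (i : Fin n)
  | rightZero (i : Fin k)
  deriving Fintype

/-- The peacock diagram with labels `(a | b | c)`, for non-empty lists `a`, `b`, `c`.
The stem is a chain of propagators of orders `a₁, a₂, …` from the root vertex to the top vertex;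
the two feathers are chains of propagators of orders `b₁, b₂, …` and `c₁, c₂, …` from the
top vertex back to the root; from every inner vertex of the three chains a propagator of order `0`
runs to the root. -/
def peacock (a b c : List ℕ) :
    FeynmanDiagram (PeacockVertex a.tail.length b.tail.length c.tail.length)
      (PeacockEdge a.tail.length b.tail.length c.tail.length) where
  src
    | .stem i => Fin.cases .root .stem i
    | .left i => Fin.cases .top .left i
    | .right i => Fin.cases .top .right i
    | .stemZero i => .stem i
    | .leftZero i => .left i
    | .rightZero i => .right i
  tgt
    | .stem i => Fin.lastCases .top .stem i
    | .left i => Fin.lastCases .root .left i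
    | .right i => Fin.lastCases .root .right i
    | .stemZero _ => .root
    | .leftZero _ => .root
    | .rightZero _ => .root
  order
    | .stem i => a.getD i 0
    | .left i => b.getD i 0
    | .right i => c.getD i 0
    | .stemZero _ => 0
    | .leftZero _ => 0
    | .rightZero _ => 0

/-- The peacock diagram with labels `(a | b | c)` has a finite value. -/
def PeacockConverges (a b c : List ℕ) : Prop := (peacock a b c).Converges

/-- The number `Z(a₁, … | b₁, … | c₁, …)` to which the peacock diagram evaluates. -/
noncomputable def peacockZ (a b c : List ℕ) : ℂ := (peacock a b c).value

/-- The summand `1 / (n₁ ^ k₁ ⋯ n_m ^ k_m)`, for `n₁ > ⋯ > n_m > 0`, of an Euler–Zagier sum. -/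
noncomputable def mzvTerm (k : List ℕ)
    (n : {n : Fin k.length → ℕ // StrictAnti n ∧ ∀ i, 0 < n i}) : ℝ :=
  ∏ i, 1 / (n.1 i : ℝ) ^ k.get i

/-- The multiple zeta value (Euler–Zagier sum) `ζ(k₁, …, k_m)`. -/
noncomputable def mzv (k : List ℕ) : ℝ := ∑' n, mzvTerm k n

/-- All entries are at least `1`. -/
def PositiveIndex (k : List ℕ) : Prop := ∀ i ∈ k, 1 ≤ i

/-- Non-empty, all entries at least `1`, first entry at least `2`. -/
def AdmissibleIndex (k : List ℕ) : Prop := PositiveIndex k ∧ 2 ≤ k.headD 0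

/-- The indices, with multiplicity, that result from `Z(d₁, …, d_l, 0 | b₁, … | c₁, …)` by applying
the partial integration rule and the exchange rule in turn until one of the feathers
is reduced to a single label `0`. A feather in which only that label `0` is left is represented
by the empty list. -/
def peacockExpansion : List ℕ → List ℕ → List ℕ → Multiset (List ℕ)
  | d, [], c => {d ++ c}
  | d, b, [] => {d ++ b}
  | d, b₁ :: b, c₁ :: c =>
      (∑ ν ∈ Finset.Icc 1 b₁, (b₁ + c₁ - ν - 1).choose (c₁ - 1) •
        peacockExpansion (d ++ [b₁ + c₁ - ν]) (ν :: b) c) +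
      (∑ ν ∈ Finset.Icc 1 c₁, (b₁ + c₁ - ν - 1).choose (b₁ - 1) •
        peacockExpansion (d ++ [b₁ + c₁ - ν]) b (ν :: c))
termination_by _ b c => b.length + c.length

/-- The shuffle product of two words: all their interleavings, with multiplicity. -/
def wordShuffle {α : Type} : List α → List α → Multiset (List α)
  | [], w => {w}
  | v, [] => {v}
  | x :: v, y :: w =>
      (wordShuffle v (y :: w)).map (fun s => x :: s) +
      (wordShuffle (x :: v) w).map (fun s => y :: s)
termination_by v w => v.length + w.length

/-- The two letters `x₀` and `x₁`. -/
inductive ZetaLetter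
  | x₀
  | x₁
  deriving DecidableEq

/-- The word `x₀^{k₁-1} x₁ x₀^{k₂-1} x₁ ⋯ x₀^{k_m-1} x₁` that encodes `ζ(k₁, …, k_m)`. -/
def zetaWord (k : List ℕ) : List ZetaLetter :=
  k.flatMap fun i => List.replicate (i - 1) ZetaLetter.x₀ ++ [ZetaLetter.x₁]

open scoped ENNReal

/-! For `r < 1` every propagator is an absolutely convergent Fourier series with positive
frequencies, and the prefactor `(2πi)^k` makes its coefficients `r ^ n / n ^ k`. Integrating over a
vertex position enforces conservation of frequency there, so the Feynman integral is a sum over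
positive integral flows (`amplitude_eq_tsum`). All terms are positive: the limit `r → 1⁻` is finite
iff the sum of the weights is, and equals it (`converges_iff`, `value_eq`). One can then compute in
`[0, ∞]`, where sums rearrange freely and convergence means `≠ ⊤`.

On a peacock, the order-0 edges to the root carry the differences of consecutive frequencies. A flow
is therefore three strictly decreasing chains of positive integers, the last stem frequency `N`
being the sum `x + y` of the first feather frequencies; this gives `peacockSum`. Partial integration
is the partial fraction expansion of `x ^ (-b₁) * y ^ (-c₁)` in powers of `1 / (x + y)`; exchange of
propagators is a change of summation variable. A lone label 0 on the stem decouples the feathers,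
and a feather consisting only of 0 makes the other one continue the stem. Alternating the two rules
turns the product into single nested sums.

Partial fractions rest on `XY = SX + SY`, shuffles on splitting off the first letter. Both produce
the same Pascal recursion, captured by `pascalSum`, hence the agreement with the shuffle product. -/

/-- A finite product of absolutely convergent series is the series of the products. -/
theorem tsum_prod_fin {𝕜 : Type*} [NormedField 𝕜] [CompleteSpace 𝕜] (n : ℕ)
    (f : Fin n → ℕ → 𝕜) (hf : ∀ i, Summable fun m => ‖f i m‖) :
    (Summable fun x : Fin n → ℕ => ‖∏ i, f i (x i)‖) ∧
      ∑' x : Fin n → ℕ, ∏ i, f i (x i) = ∏ i, ∑' m, f i m := by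
  induction n with
  | zero => simp [Summable.of_finite]
  | succ n ih =>
    obtain ⟨h₁, h₂⟩ := ih (fun i => f i.succ) fun i => hf i.succ
    have key : ∀ p : ℕ × (Fin n → ℕ),
        ∏ i, f i (Fin.consEquiv (fun _ => ℕ) p i) = f 0 p.1 * ∏ i, f i.succ (p.2 i) := by
      rintro ⟨a, x⟩
      simp [Fin.prod_univ_succ, Fin.consEquiv]
    constructor
    · rw [← (Fin.consEquiv fun _ => ℕ).summable_iff]
      refine (Summable.mul_norm (hf 0) h₁).congr fun p => ?_
      simp only [Function.comp, key]
    · rw [← (Fin.consEquiv fun _ => ℕ).tsum_eq, Fin.prod_univ_succ, ← h₂,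
        tsum_mul_tsum_of_summable_norm (hf 0) h₁]
      simp only [key]

theorem tsum_prod_fintype {ι 𝕜 : Type*} [Fintype ι] [NormedField 𝕜] [CompleteSpace 𝕜]
    (f : ι → ℕ → 𝕜) (hf : ∀ i, Summable fun m => ‖f i m‖) :
    (Summable fun x : ι → ℕ => ‖∏ i, f i (x i)‖) ∧
      ∑' x : ι → ℕ, ∏ i, f i (x i) = ∏ i, ∑' m, f i m := by
  classical
  let e := Fintype.equivFin ι
  obtain ⟨h₁, h₂⟩ := tsum_prod_fin _ (fun i => f (e.symm i)) fun i => hf _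
  have key : ∀ x : Fin (Fintype.card ι) → ℕ,
      ∏ i, f i ((e.arrowCongr (Equiv.refl ℕ)).symm x i) = ∏ i, f (e.symm i) (x i) := by
    intro x
    rw [← e.prod_comp fun i => f (e.symm i) (x i)]
    simp
  constructor
  · rw [← (e.arrowCongr (Equiv.refl ℕ)).symm.summable_iff]
    simpa only [Function.comp_def, key] using h₁
  · rw [← (e.arrowCongr (Equiv.refl ℕ)).symm.tsum_eq]
    simp only [key]
    rw [h₂, e.symm.prod_comp fun i => ∑' m, f i m]

/-! ### Characters of the circle -/

theorem integral_fourier_unitAddCircle (n : ℤ) :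
    ∫ u : UnitAddCircle, fourier n u = if n = 0 then 1 else 0 := by
  have h := fourierCoeff_fourier (T := 1) n
  have h0 := congrFun h 0
  simp only [fourierCoeff, neg_zero, fourier_zero, one_smul] at h0
  rw [Pi.single_apply] at h0
  have hv : (MeasureTheory.volume : MeasureTheory.Measure UnitAddCircle)
      = AddCircle.haarAddCircle := by
    simpa using AddCircle.volume_eq_smul_haarAddCircle (T := 1)
  rw [hv, h0]
  simp only [eq_comm]

theorem fourier_sum_index {ι : Type*} (s : Finset ι) (n : ι → ℤ) (u : UnitAddCircle) :
    fourier (∑ i ∈ s, n i) u = ∏ i ∈ s, fourier (n i) u := by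
  classical
  induction s using Finset.induction_on with
  | empty => simp
  | insert i s hi ih => rw [Finset.sum_insert hi, Finset.prod_insert hi, fourier_add, ih]

theorem fourier_sub_arg (n : ℤ) (u v : UnitAddCircle) :
    fourier n (u - v) = fourier n u * fourier (-n) v := by
  rw [fourier_apply, fourier_apply, fourier_apply, smul_sub, sub_eq_add_neg,
    AddCircle.toCircle_add, Circle.coe_mul, neg_smul]

/-! ### Feynman integrals as sums over flows -/

namespace FeynmanDiagram

variable {V E : Type} [Fintype E]

/-- The net frequency leaving the vertex `v` when the propagator `e` carries frequency
`x e + 1`. -/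
def netFlow [DecidableEq V] (D : FeynmanDiagram V E) (x : E → ℕ) (v : V) : ℤ :=
  ∑ e, ((if D.src e = v then (x e + 1 : ℤ) else 0) - (if D.tgt e = v then (x e + 1 : ℤ) else 0))

/-- Frequencies obey conservation at every vertex. -/
def IsFlow [DecidableEq V] (D : FeynmanDiagram V E) (x : E → ℕ) : Prop := ∀ v, D.netFlow x v = 0

/-- The weight of a family of frequencies. -/
noncomputable def weight (D : FeynmanDiagram V E) (x : E → ℕ) : ℝ :=
  ∏ e, 1 / (x e + 1 : ℝ) ^ D.order e

theorem weight_pos (D : FeynmanDiagram V E) (x : E → ℕ) : 0 < D.weight x :=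
  Finset.prod_pos fun _ _ => by positivity

theorem prod_coeff_eq (D : FeynmanDiagram V E) (r : ℝ) (x : E → ℕ) :
    ∏ e, (r ^ (x e + 1) * (1 / (x e + 1 : ℝ) ^ D.order e)) = r ^ (∑ e, (x e + 1)) * D.weight x := by
  rw [Finset.prod_mul_distrib, Finset.prod_pow_eq_pow_sum]; rfl

/-- The sum of the weights over all positive flows. -/
noncomputable def flowSum [DecidableEq V] (D : FeynmanDiagram V E) : ℝ≥0∞ :=
  ∑' x : {x // D.IsFlow x}, ENNReal.ofReal (D.weight x.1)

theorem flowSum_ne_top_iff [DecidableEq V] (D : FeynmanDiagram V E) :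
    D.flowSum ≠ ⊤ ↔ Summable fun x : {x // D.IsFlow x} => D.weight x.1 := by
  refine ⟨fun h => ?_, fun h => h.tsum_ofReal_ne_top⟩
  refine (ENNReal.summable_toReal h).congr fun x => ?_
  rw [ENNReal.toReal_ofReal (D.weight_pos x.1).le]

variable [Fintype V]

instance [DecidableEq V] (D : FeynmanDiagram V E) (x : E → ℕ) : Decidable (D.IsFlow x) :=
  inferInstanceAs (Decidable (∀ v, D.netFlow x v = 0))

/-- Characters are multiplicative in frequency and in position, so the factors can be regrouped from
edges to vertices. -/
theorem prod_fourier_eq [DecidableEq V] (D : FeynmanDiagram V E) (x : E → ℕ)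
    (u : V → UnitAddCircle) :
    ∏ e, fourier ((x e : ℤ) + 1) (u (D.src e) - u (D.tgt e)) =
      ∏ v, fourier (D.netFlow x v) (u v) := by
  simp only [netFlow, fourier_sum_index]
  rw [Finset.prod_comm]
  refine Finset.prod_congr rfl fun e _ => ?_
  rw [fourier_sub_arg]
  simp only [sub_eq_add_neg, fourier_add, Finset.prod_mul_distrib]
  congr 1
  · rw [Finset.prod_eq_single (D.src e)] <;> simp +contextual [eq_comm]
  · rw [Finset.prod_eq_single (D.tgt e)] <;> simp +contextual [eq_comm]

theorem integral_prod_fourier [DecidableEq V] (D : FeynmanDiagram V E) (x : E → ℕ) :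
    ∫ u : V → UnitAddCircle, ∏ e, fourier ((x e : ℤ) + 1) (u (D.src e) - u (D.tgt e)) =
      if D.IsFlow x then 1 else 0 := by
  simp only [prod_fourier_eq]
  rw [MeasureTheory.integral_fintype_prod_volume_eq_prod
    (fun v (t : UnitAddCircle) => (fourier (D.netFlow x v) t : ℂ))]
  simp only [integral_fourier_unitAddCircle]
  rw [Finset.prod_ite_zero, Finset.prod_const_one]
  by_cases h : D.IsFlow x
  · rw [if_pos h, if_pos fun v _ => h v]
  · rw [if_neg h, if_neg fun h' => h fun v => h' v (Finset.mem_univ v)]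

theorem _root_.two_pi_I_pow_mul_propagator (r : ℝ) (k : ℕ) (u : UnitAddCircle) :
    (2 * (Real.pi : ℂ) * Complex.I) ^ k * propagator r k u =
      ∑' n : ℕ, ((r ^ (n + 1) * (1 / (n + 1 : ℝ) ^ k) : ℝ) : ℂ) * fourier ((n : ℤ) + 1) u := by
  rw [propagator, ← tsum_mul_left]
  refine tsum_congr fun n => ?_
  have h1 : (2 * (Real.pi : ℂ) * Complex.I) ≠ 0 := Complex.two_pi_I_ne_zero
  have h2 : ((n : ℂ) + 1) ≠ 0 := Nat.cast_add_one_ne_zero n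
  rw [mul_pow (2 * (Real.pi : ℂ) * Complex.I)]
  push_cast
  field_simp

theorem _root_.summable_pow_mul_inv_pow {r : ℝ} (h0 : 0 < r) (h1 : r < 1) (k : ℕ) :
    Summable fun n : ℕ => r ^ (n + 1) * (1 / (n + 1 : ℝ) ^ k) := by
  refine Summable.of_nonneg_of_le (fun n => by positivity) (fun n => ?_)
    ((summable_nat_add_iff 1).2 (summable_geometric_of_lt_one h0.le h1))
  refine mul_le_of_le_one_right (by positivity) ?_
  rw [div_le_one (by positivity)]
  exact one_le_pow₀ (by linarith [Nat.cast_nonneg (α := ℝ) n])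

/-- The Feynman integral, Fourier expanded: a sum over all positive flows. -/
theorem amplitude_eq_tsum [DecidableEq V] (D : FeynmanDiagram V E) {r : ℝ} (h0 : 0 < r)
    (h1 : r < 1) :
    (Summable fun x : {x // D.IsFlow x} => r ^ (∑ e, (x.1 e + 1)) * D.weight x.1) ∧
    D.amplitude r =
      ((∑' x : {x // D.IsFlow x}, r ^ (∑ e, (x.1 e + 1)) * D.weight x.1 : ℝ) : ℂ) := by
  have hs : Summable fun x : E → ℕ => r ^ (∑ e, (x e + 1)) * D.weight x := by
    have := (tsum_prod_fintype
      (fun (e : E) (n : ℕ) => r ^ (n + 1) * (1 / (n + 1 : ℝ) ^ D.order e)) fun e =>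
        (summable_pow_mul_inv_pow h0 h1 _).norm).1.of_norm
    simpa only [prod_coeff_eq] using this
  refine ⟨hs.subtype _, ?_⟩
  have hexp : ∀ u : V → UnitAddCircle,
      (∏ e : E, (2 * (Real.pi : ℂ) * Complex.I) ^ D.order e *
        propagator r (D.order e) (u (D.src e) - u (D.tgt e))) =
      ∑' x : E → ℕ, ((r ^ (∑ e, (x e + 1)) * D.weight x : ℝ) : ℂ) *
        ∏ e, fourier ((x e : ℤ) + 1) (u (D.src e) - u (D.tgt e)) := by
    intro u
    simp only [two_pi_I_pow_mul_propagator]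
    rw [← (tsum_prod_fintype (fun (e : E) (n : ℕ) =>
      ((r ^ (n + 1) * (1 / (n + 1 : ℝ) ^ D.order e) : ℝ) : ℂ) *
        fourier ((n : ℤ) + 1) (u (D.src e) - u (D.tgt e))) ?_).2]
    · refine tsum_congr fun x => ?_
      rw [Finset.prod_mul_distrib, ← prod_coeff_eq, Complex.ofReal_prod]
    · intro e
      refine (summable_pow_mul_inv_pow h0 h1 (D.order e)).congr fun n => ?_
      have hc : ‖(fourier ((n : ℤ) + 1) (u (D.src e) - u (D.tgt e)) : ℂ)‖ = 1 := by
        rw [fourier_apply]; exact Circle.norm_coe _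
      rw [norm_mul, hc, mul_one, Complex.norm_real, Real.norm_of_nonneg (by positivity)]
  have hnorm : ∀ (x : E → ℕ) (u : V → UnitAddCircle),
      ‖((r ^ (∑ e, (x e + 1)) * D.weight x : ℝ) : ℂ) *
        ∏ e, fourier ((x e : ℤ) + 1) (u (D.src e) - u (D.tgt e))‖ =
        r ^ (∑ e, (x e + 1)) * D.weight x := by
    intro x u
    have hc : ∀ e, ‖(fourier ((x e : ℤ) + 1) (u (D.src e) - u (D.tgt e)) : ℂ)‖ = 1 := by
      intro e; rw [fourier_apply]; exact Circle.norm_coe _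
    have := (D.weight_pos x).le
    rw [norm_mul, norm_prod, Finset.prod_congr rfl fun e _ => hc e, Finset.prod_const_one,
      mul_one, Complex.norm_real, Real.norm_of_nonneg (by positivity)]
  unfold amplitude
  simp only [hexp]
  -- Sum and integral commute: characters have modulus 1 and the torus has volume 1, so the
  -- integrals of the norms are the summable coefficients `hs`.
  rw [← MeasureTheory.integral_tsum_of_summable_integral_norm]
  · simp only [MeasureTheory.integral_const_mul, integral_prod_fourier]
    rw [Complex.ofReal_tsum]
    refine Eq.trans ?_ (tsum_subtype {x | D.IsFlow x}
      fun x => ((r ^ (∑ e, (x e + 1)) * D.weight x : ℝ) : ℂ)).symm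
    refine tsum_congr fun x => ?_
    simp [Set.indicator_apply]
  · intro x
    refine Continuous.integrable_of_hasCompactSupport (by fun_prop) ?_
    exact HasCompactSupport.of_compactSpace _
  · simp only [hnorm]
    have hv : (MeasureTheory.volume : MeasureTheory.Measure (V → UnitAddCircle)).real
        Set.univ = 1 := by
      simp [MeasureTheory.Measure.real, MeasureTheory.volume_pi, MeasureTheory.Measure.pi_univ]
    simpa [hv] using hs

/-- Dominated convergence, with the weights themselves as majorant. -/
theorem tendsto_amplitude [DecidableEq V] (D : FeynmanDiagram V E)
    (hs : Summable fun x : {x // D.IsFlow x} => D.weight x.1) :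
    Tendsto D.amplitude (𝓝[<] 1) (𝓝 ((∑' x : {x // D.IsFlow x}, D.weight x.1 : ℝ) : ℂ)) := by
  have hev : ∀ᶠ r : ℝ in 𝓝[<] 1, r ∈ Set.Ioo (0 : ℝ) 1 :=
    Ioo_mem_nhdsLT zero_lt_one
  have ht : Tendsto (fun r : ℝ => ∑' x : {x // D.IsFlow x}, r ^ (∑ e, (x.1 e + 1)) * D.weight x.1)
      (𝓝[<] 1) (𝓝 (∑' x : {x // D.IsFlow x}, D.weight x.1)) := by
    refine tendsto_tsum_of_dominated_convergence hs (fun x => ?_) ?_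
    · have : ContinuousAt (fun r : ℝ => r ^ (∑ e, (x.1 e + 1)) * D.weight x.1) 1 := by fun_prop
      simpa using this.tendsto.mono_left nhdsWithin_le_nhds
    · filter_upwards [hev] with r hr x
      have := (D.weight_pos x.1).le
      rw [Real.norm_of_nonneg (mul_nonneg (pow_nonneg hr.1.le _) this)]
      exact mul_le_of_le_one_left this (pow_le_one₀ hr.1.le hr.2.le)
  refine Tendsto.congr' ?_ ((Complex.continuous_ofReal.tendsto _).comp ht)
  filter_upwards [hev] with r hr
  exact (D.amplitude_eq_tsum hr.1 hr.2).2.symm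

/-- By positivity, a finite partial sum at `r` is at most the amplitude at `r`; letting `r → 1⁻`
bounds all partial sums of the weights by the limit. -/
theorem Converges.summable [DecidableEq V] {D : FeynmanDiagram V E} (h : D.Converges) :
    Summable fun x : {x // D.IsFlow x} => D.weight x.1 := by
  obtain ⟨z, hz⟩ := h
  have hev : ∀ᶠ r : ℝ in 𝓝[<] 1, r ∈ Set.Ioo (0 : ℝ) 1 :=
    Ioo_mem_nhdsLT zero_lt_one
  refine summable_of_sum_le (c := z.re) (fun x => (D.weight_pos x.1).le) fun s => ?_
  have h1 : Tendsto (fun r : ℝ => ∑ x ∈ s, r ^ (∑ e, (x.1 e + 1)) * D.weight x.1) (𝓝[<] 1)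
      (𝓝 (∑ x ∈ s, D.weight x.1)) := by
    have : ContinuousAt (fun r : ℝ => ∑ x ∈ s, r ^ (∑ e, (x.1 e + 1)) * D.weight x.1) 1 := by
      fun_prop
    simpa using this.tendsto.mono_left nhdsWithin_le_nhds
  refine le_of_tendsto_of_tendsto h1 ((Complex.continuous_re.tendsto z).comp hz) ?_
  filter_upwards [hev] with r hr
  obtain ⟨h2, h3⟩ := D.amplitude_eq_tsum hr.1 hr.2
  simp only [Function.comp, h3, Complex.ofReal_re]
  exact h2.sum_le_tsum _ fun x _ => mul_nonneg (pow_nonneg hr.1.le _) (D.weight_pos x.1).le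

theorem converges_iff [DecidableEq V] (D : FeynmanDiagram V E) :
    D.Converges ↔ D.flowSum ≠ ⊤ := by
  rw [flowSum_ne_top_iff]
  exact ⟨Converges.summable, fun h => ⟨_, D.tendsto_amplitude h⟩⟩

theorem value_eq [DecidableEq V] (D : FeynmanDiagram V E) (h : D.flowSum ≠ ⊤) :
    D.value = (D.flowSum.toReal : ℂ) := by
  rw [value, (D.tendsto_amplitude (D.flowSum_ne_top_iff.1 h)).limUnder_eq, flowSum,
    ENNReal.tsum_toReal_eq fun _ => ENNReal.ofReal_ne_top]
  simp only [ENNReal.toReal_ofReal (D.weight_pos _).le]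

end FeynmanDiagram

/-! ### Nested sums -/

/-- `n ^ (-k)` in `[0, ∞]`. -/
noncomputable def invPow (k n : ℕ) : ℝ≥0∞ := ENNReal.ofReal (1 / (n : ℝ) ^ k)

@[simp] theorem invPow_zero (n : ℕ) : invPow 0 n = 1 := by simp [invPow]

/-- The sum of `n₁ ^ (-k₁) ⋯ n_m ^ (-k_m) * g n_m` over `M > n₁ > ⋯ > n_m > 0`, which is `g M` when
`m = 0`. -/
noncomputable def chainSum : List ℕ → (ℕ∞ → ℝ≥0∞) → ℕ∞ → ℝ≥0∞
  | [], g, M => g M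
  | k :: ks, g, M => ∑' n : ℕ, if 0 < n ∧ (n : ℕ∞) < M then invPow k n * chainSum ks g n else 0

/-- The terminal function `g` absorbs the tail of a chain, so that rules acting at the lower end of
the stem become identities between terminal functions. -/
theorem chainSum_append (a b : List ℕ) (g : ℕ∞ → ℝ≥0∞) (M : ℕ∞) :
    chainSum (a ++ b) g M = chainSum a (chainSum b g) M := by
  induction a generalizing M with
  | nil => rfl
  | cons k a ih => simp only [List.cons_append, chainSum, ih]

/-- A non-empty chain evaluates its terminal function only at positive finite arguments, where the
feather identities are available. -/
theorem chainSum_congr {a : List ℕ} (ha : a ≠ []) {g h : ℕ∞ → ℝ≥0∞}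
    (hgh : ∀ n : ℕ, 0 < n → g n = h n) (M : ℕ∞) : chainSum a g M = chainSum a h M := by
  induction a generalizing M with
  | nil => exact absurd rfl ha
  | cons k a ih =>
    refine tsum_congr fun n => ?_
    split_ifs with hn
    · rcases eq_or_ne a [] with rfl | ha'
      · simp only [chainSum, hgh n hn.1]
      · rw [ih ha']
    · rfl

/-- `M > x₀ > x₁ > ⋯ > 0`. -/
def DescendsFrom {n : ℕ} (M : ℕ∞) (x : Fin n → ℕ) : Prop :=
  (∀ i, 0 < x i) ∧
    ∀ i : Fin n, (x i : ℕ∞) < (Fin.cons M fun j => (x j : ℕ∞) : Fin (n + 1) → ℕ∞) i.castSucc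

/-- The last entry of `M, x₀, x₁, …`. -/
def lastFrom {n : ℕ} (M : ℕ∞) (x : Fin n → ℕ) : ℕ∞ :=
  (Fin.cons M fun j => (x j : ℕ∞) : Fin (n + 1) → ℕ∞) (Fin.last n)

theorem descendsFrom_cons {n : ℕ} (M : ℕ∞) (m : ℕ) (x : Fin n → ℕ) :
    DescendsFrom M (Fin.cons m x : Fin (n + 1) → ℕ) ↔
      (0 < m ∧ (m : ℕ∞) < M) ∧ DescendsFrom m x := by
  have h : (fun j => ((Fin.cons m x : Fin (n + 1) → ℕ) j : ℕ∞)) =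
      Fin.cons (m : ℕ∞) fun j => (x j : ℕ∞) := by
    funext j; refine Fin.cases ?_ (fun j => ?_) j <;> simp
  simp only [DescendsFrom, h, Fin.forall_fin_succ (n := n), Fin.castSucc_zero,
    ← Fin.succ_castSucc, Fin.cons_succ, Fin.cons_zero]
  tauto

theorem lastFrom_cons {n : ℕ} (M : ℕ∞) (m : ℕ) (x : Fin n → ℕ) :
    lastFrom M (Fin.cons m x : Fin (n + 1) → ℕ) = lastFrom m x := by
  have h : (fun j => ((Fin.cons m x : Fin (n + 1) → ℕ) j : ℕ∞)) =
      Fin.cons (m : ℕ∞) fun j => (x j : ℕ∞) := by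
    funext j; refine Fin.cases ?_ (fun j => ?_) j <;> simp
  rw [lastFrom, h, ← Fin.succ_last, Fin.cons_succ]; rfl

theorem lastFrom_succ {n : ℕ} (M : ℕ∞) (x : Fin (n + 1) → ℕ) :
    lastFrom M x = x (Fin.last n) := by
  rw [lastFrom, ← Fin.succ_last, Fin.cons_succ]

theorem descendsFrom_top_iff {n : ℕ} (x : Fin (n + 1) → ℕ) :
    DescendsFrom ⊤ x ↔ (∀ i, 0 < x i) ∧ StrictAnti x := by
  rw [DescendsFrom, Fin.strictAnti_iff_succ_lt]
  refine and_congr_right fun _ => ?_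
  rw [Fin.forall_fin_succ (n := n)]
  simp only [Fin.castSucc_zero, ← Fin.succ_castSucc, Fin.cons_succ, Fin.cons_zero]
  simp

theorem prod_invPow_cons (k : ℕ) (ks : List ℕ) (n : ℕ) (x : Fin ks.length → ℕ) :
    ∏ i : Fin (ks.length + 1), invPow ((k :: ks).get i) ((Fin.cons n x : Fin _ → ℕ) i) =
      invPow k n * ∏ i, invPow (ks.get i) (x i) := by
  rw [Fin.prod_univ_succ]; rfl

open Classical in
theorem chainSum_eq_tsum (k : List ℕ) (g : ℕ∞ → ℝ≥0∞) (M : ℕ∞) :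
    chainSum k g M = ∑' x : Fin k.length → ℕ,
      if DescendsFrom M x then (∏ i, invPow (k.get i) (x i)) * g (lastFrom M x) else 0 := by
  induction k generalizing M with
  | nil =>
    rw [tsum_eq_single (default : Fin ([] : List ℕ).length → ℕ) fun y hy =>
      absurd (funext fun i => i.elim0) hy, if_pos ⟨fun i => i.elim0, fun i => i.elim0⟩]
    simp [chainSum, lastFrom]
  | cons k ks ih =>
    simp only [List.length_cons]
    rw [← (Fin.consEquiv fun _ => ℕ).tsum_eq, ENNReal.tsum_prod']
    refine tsum_congr fun n => ?_
    simp only [Fin.consEquiv, Equiv.coe_fn_mk, descendsFrom_cons, lastFrom_cons]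
    rw [ih, ← ENNReal.tsum_mul_left]
    split_ifs with h
    · refine tsum_congr fun x => ?_
      rw [prod_invPow_cons]
      simp only [h, true_and, and_self]
      split_ifs
      · simp [mul_assoc]
      · simp
    · symm
      simp [h]

theorem ofReal_mzvTerm (k : List ℕ) (n) :
    ENNReal.ofReal (mzvTerm k n) = ∏ i, invPow (k.get i) (n.1 i) := by
  rw [mzvTerm, ENNReal.ofReal_prod_of_nonneg fun i _ => by positivity]
  rfl

theorem mzvTerm_pos (k : List ℕ) (n) : 0 < mzvTerm k n :=
  Finset.prod_pos fun i _ => by have := n.2.2 i; positivity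

theorem tsum_ofReal_mzvTerm (k : List ℕ) :
    ∑' n, ENNReal.ofReal (mzvTerm k n) = chainSum k (fun _ => 1) ⊤ := by
  classical
  simp only [ofReal_mzvTerm]
  rw [chainSum_eq_tsum]
  refine (tsum_subtype {n : Fin k.length → ℕ | StrictAnti n ∧ ∀ i, 0 < n i}
    fun n => ∏ i, invPow (k.get i) (n i)).trans (tsum_congr fun x => ?_)
  rw [Set.indicator_apply, mul_one]
  refine if_congr ?_ rfl rfl
  cases k with
  | nil =>
    exact ⟨fun _ => ⟨fun i => i.elim0, fun i => i.elim0⟩,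
      fun _ => ⟨fun i => i.elim0, fun i => i.elim0⟩⟩
  | cons k ks => exact and_comm.trans (descendsFrom_top_iff x).symm

theorem summable_mzvTerm_iff (k : List ℕ) :
    Summable (mzvTerm k) ↔ chainSum k (fun _ => 1) ⊤ ≠ ⊤ := by
  rw [← tsum_ofReal_mzvTerm]
  refine ⟨fun h => h.tsum_ofReal_ne_top, fun h => (ENNReal.summable_toReal h).congr fun x => ?_⟩
  rw [ENNReal.toReal_ofReal (mzvTerm_pos k x).le]

theorem mzv_eq (k : List ℕ) : mzv k = (chainSum k (fun _ => 1) ⊤).toReal := by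
  rw [← tsum_ofReal_mzvTerm, ENNReal.tsum_toReal_eq fun _ => ENNReal.ofReal_ne_top]
  simp only [ENNReal.toReal_ofReal (mzvTerm_pos k _).le]
  rfl

/-! ### Feather sums and peacock sums -/

/-- The sum over a feather whose first propagator carries the frequency `p`. -/
noncomputable def featherSum : List ℕ → ℕ → ℝ≥0∞
  | [], _ => 0
  | k :: ks, p => invPow k p * chainSum ks (fun _ => 1) p

/-- The sum over two feathers that are fed with the total frequency `N`. -/
noncomputable def featherPairSum (b c : List ℕ) (N : ℕ∞) : ℝ≥0∞ :=
  ∑' (p : ℕ) (q : ℕ), if 0 < p ∧ 0 < q ∧ ((p + q : ℕ) : ℕ∞) = N then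
    featherSum b p * featherSum c q else 0

/-- The value of a peacock diagram, in `[0, ∞]`. -/
noncomputable def peacockSum (a b c : List ℕ) : ℝ≥0∞ := chainSum a (featherPairSum b c) ⊤

-- The weight `h` depends only on the first frequency, which lets the two coupled feathers be
-- unfolded one after the other.
open Classical in
theorem tsum_featherSum_mul (b₀ : ℕ) (b : List ℕ) (h : ℕ → ℝ≥0∞) :
    (∑' p : ℕ, if 0 < p then featherSum (b₀ :: b) p * h p else 0) =
      ∑' y : Fin (b.length + 1) → ℕ, if DescendsFrom ⊤ y then
        (∏ i, invPow ((b₀ :: b).get i) (y i)) * h (y 0) else 0 := by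
  rw [← (Fin.consEquiv fun _ => ℕ).tsum_eq, ENNReal.tsum_prod']
  refine tsum_congr fun p => ?_
  simp only [Fin.consEquiv, Equiv.coe_fn_mk, descendsFrom_cons, featherSum, chainSum_eq_tsum]
  split_ifs with hp
  · rw [← ENNReal.tsum_mul_left, ← ENNReal.tsum_mul_right]
    refine tsum_congr fun y => ?_
    have := prod_invPow_cons b₀ b p y
    simp only [List.length_cons] at this ⊢
    rw [this]
    simp only [hp, ENat.natCast_lt_top, and_self, true_and, Fin.cons_zero]
    split_ifs <;> simp
  · simp [hp]

open Classical in
theorem featherPairSum_eq_tsum (b₀ c₀ : ℕ) (b c : List ℕ) (N : ℕ) :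
    featherPairSum (b₀ :: b) (c₀ :: c) N =
      ∑' (y : Fin (b.length + 1) → ℕ) (z : Fin (c.length + 1) → ℕ),
        if DescendsFrom ⊤ y ∧ DescendsFrom ⊤ z ∧ y 0 + z 0 = N then
          (∏ i, invPow ((b₀ :: b).get i) (y i)) * ∏ i, invPow ((c₀ :: c).get i) (z i) else 0 := by
  -- The coupling `p + q = N` is moved into an indicator factor, which serves as the weight for
  -- unfolding each feather.
  have h1 : featherPairSum (b₀ :: b) (c₀ :: c) N = ∑' p : ℕ, if 0 < p then
      featherSum (b₀ :: b) p * (∑' q : ℕ, if 0 < q then featherSum (c₀ :: c) q *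
        (if p + q = N then 1 else 0) else 0) else 0 := by
    refine tsum_congr fun p => ?_
    split_ifs with hp
    · rw [← ENNReal.tsum_mul_left]
      refine tsum_congr fun q => ?_
      by_cases hq : 0 < q <;> by_cases hN : p + q = N <;>
        simp [-Nat.cast_add, hp, hq, hN]
    · simp [hp]
  rw [h1, tsum_featherSum_mul b₀ b]
  refine tsum_congr fun y => ?_
  rw [tsum_featherSum_mul]
  split_ifs with hy
  · rw [← ENNReal.tsum_mul_left]
    refine tsum_congr fun z => ?_
    by_cases hz : DescendsFrom ⊤ z <;> by_cases hN : y 0 + z 0 = N <;> simp [hy, hz, hN]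
  · simp [hy]

/-! ### Flows on peacock diagrams -/

section Flow

variable {m n k : ℕ}

/-- The propagators of a peacock diagram, by kind. -/
def peacockEdgeEquiv (m n k : ℕ) :
    PeacockEdge m n k ≃
      (Fin (m + 1) ⊕ Fin (n + 1) ⊕ Fin (k + 1)) ⊕ (Fin m ⊕ Fin n ⊕ Fin k) where
  toFun
    | .stem i => .inl (.inl i)
    | .left i => .inl (.inr (.inl i))
    | .right i => .inl (.inr (.inr i))
    | .stemZero i => .inr (.inl i)
    | .leftZero i => .inr (.inr (.inl i))
    | .rightZero i => .inr (.inr (.inr i))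
  invFun
    | .inl (.inl i) => .stem i
    | .inl (.inr (.inl i)) => .left i
    | .inl (.inr (.inr i)) => .right i
    | .inr (.inl i) => .stemZero i
    | .inr (.inr (.inl i)) => .leftZero i
    | .inr (.inr (.inr i)) => .rightZero i
  left_inv := by rintro (_ | _ | _ | _ | _ | _) <;> rfl
  right_inv := by rintro ((_ | _ | _) | (_ | _ | _)) <;> rfl

theorem prod_peacockEdge {α : Type*} [CommMonoid α] (f : PeacockEdge m n k → α) :
    ∏ e, f e = ((∏ i, f (.stem i)) * ((∏ i, f (.left i)) * ∏ i, f (.right i))) *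
      ((∏ i, f (.stemZero i)) * ((∏ i, f (.leftZero i)) * ∏ i, f (.rightZero i))) := by
  rw [← (peacockEdgeEquiv m n k).symm.prod_comp]
  simp only [Fintype.prod_sum_type]
  rfl

theorem sum_peacockEdge {α : Type*} [AddCommMonoid α] (f : PeacockEdge m n k → α) :
    ∑ e, f e = ((∑ i, f (.stem i)) + ((∑ i, f (.left i)) + ∑ i, f (.right i))) +
      ((∑ i, f (.stemZero i)) + ((∑ i, f (.leftZero i)) + ∑ i, f (.rightZero i))) :=
  prod_peacockEdge (α := Multiplicative α) f

/-- Each edge leaves one vertex and enters one, so its contributions cancel. One conservation law is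
thus redundant. -/
theorem FeynmanDiagram.sum_netFlow {V E : Type} [Fintype V] [Fintype E] [DecidableEq V]
    (D : FeynmanDiagram V E) (x : E → ℕ) : ∑ v, D.netFlow x v = 0 := by
  simp only [netFlow]
  rw [Finset.sum_comm]
  refine Finset.sum_eq_zero fun e _ => ?_
  simp [Finset.sum_sub_distrib]

/-- The diagram with the shape of a peacock and arbitrary orders on the stem and the feathers. -/
def peacockOf (α : Fin (m + 1) → ℕ) (β : Fin (n + 1) → ℕ) (γ : Fin (k + 1) → ℕ) :
    FeynmanDiagram (PeacockVertex m n k) (PeacockEdge m n k) where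
  src
    | .stem i => Fin.cases .root .stem i
    | .left i => Fin.cases .top .left i
    | .right i => Fin.cases .top .right i
    | .stemZero i => .stem i
    | .leftZero i => .left i
    | .rightZero i => .right i
  tgt
    | .stem i => Fin.lastCases .top .stem i
    | .left i => Fin.lastCases .root .left i
    | .right i => Fin.lastCases .root .right i
    | .stemZero _ => .root
    | .leftZero _ => .root
    | .rightZero _ => .root
  order
    | .stem i => α i
    | .left i => β i
    | .right i => γ i
    | .stemZero _ => 0
    | .leftZero _ => 0
    | .rightZero _ => 0

/-- These are the conservation laws at the top and at the inner vertices; the one at the root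
follows from them. The `+ 1` remains because the edge `e` carries the frequency `x e + 1`. -/
theorem isFlow_peacockOf_iff [DecidableEq (PeacockVertex m n k)] (α : Fin (m + 1) → ℕ)
    (β : Fin (n + 1) → ℕ) (γ : Fin (k + 1) → ℕ) (x : PeacockEdge m n k → ℕ) :
    (peacockOf α β γ).IsFlow x ↔
      (x (.left 0) + x (.right 0) + 1 = x (.stem (Fin.last _))) ∧
      (∀ i, x (.stem (Fin.succ i)) + x (.stemZero i) + 1 = x (.stem (Fin.castSucc i))) ∧
      (∀ i, x (.left (Fin.succ i)) + x (.leftZero i) + 1 = x (.left (Fin.castSucc i))) ∧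
      (∀ i, x (.right (Fin.succ i)) + x (.rightZero i) + 1 = x (.right (Fin.castSucc i))) := by
  set D := peacockOf α β γ with hD
  have hcases : ∀ {N : ℕ} (r : PeacockVertex m n k) (s : Fin N → PeacockVertex m n k)
      (F : Fin (N + 1) → ℤ) (w : PeacockVertex m n k),
      (∑ j, if (Fin.cases r s j : PeacockVertex m n k) = w then F j else 0) =
        (if r = w then F 0 else 0) + ∑ j, if s j = w then F j.succ else 0 := by
    intro N r s F w; rw [Fin.sum_univ_succ]; rfl
  have hlast : ∀ {N : ℕ} (r : PeacockVertex m n k) (s : Fin N → PeacockVertex m n k)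
      (F : Fin (N + 1) → ℤ) (w : PeacockVertex m n k),
      (∑ j, if (Fin.lastCases r s j : PeacockVertex m n k) = w then F j else 0) =
        (∑ j, if s j = w then F j.castSucc else 0) + if r = w then F (Fin.last N) else 0 := by
    intro N r s F w; rw [Fin.sum_univ_castSucc]; simp
  have key : ∀ w, D.netFlow x w =
      (((if .root = w then (x (.stem 0) + 1 : ℤ) else 0) +
        ∑ j, if .stem j = w then (x (.stem j.succ) + 1 : ℤ) else 0) +
      (((if .top = w then (x (.left 0) + 1 : ℤ) else 0) +
        ∑ j, if .left j = w then (x (.left j.succ) + 1 : ℤ) else 0) +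
      ((if .top = w then (x (.right 0) + 1 : ℤ) else 0) +
        ∑ j, if .right j = w then (x (.right j.succ) + 1 : ℤ) else 0)) +
      ((∑ j, if .stem j = w then (x (.stemZero j) + 1 : ℤ) else 0) +
      ((∑ j, if .left j = w then (x (.leftZero j) + 1 : ℤ) else 0) +
        ∑ j, if .right j = w then (x (.rightZero j) + 1 : ℤ) else 0))) -
      (((∑ j, if .stem j = w then (x (.stem (Fin.castSucc j)) + 1 : ℤ) else 0) +
        if .top = w then (x (.stem (Fin.last _)) + 1 : ℤ) else 0) +
      (((∑ j, if .left j = w then (x (.left (Fin.castSucc j)) + 1 : ℤ) else 0) +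
        if .root = w then (x (.left (Fin.last _)) + 1 : ℤ) else 0) +
      ((∑ j, if .right j = w then (x (.right (Fin.castSucc j)) + 1 : ℤ) else 0) +
        if .root = w then (x (.right (Fin.last _)) + 1 : ℤ) else 0)) +
      ((∑ j, if .root = w then (x (.stemZero j) + 1 : ℤ) else 0) +
      ((∑ j, if .root = w then (x (.leftZero j) + 1 : ℤ) else 0) +
        ∑ j, if .root = w then (x (.rightZero j) + 1 : ℤ) else 0))) := fun w => by
    rw [FeynmanDiagram.netFlow, Finset.sum_sub_distrib, sum_peacockEdge, sum_peacockEdge]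
    simp only [hD, peacockOf]
    rw [hcases _ _ (fun j => (x (.stem j) + 1 : ℤ)), hcases _ _ (fun j => (x (.left j) + 1 : ℤ)),
      hcases _ _ (fun j => (x (.right j) + 1 : ℤ)), hlast _ _ (fun j => (x (.stem j) + 1 : ℤ)),
      hlast _ _ (fun j => (x (.left j) + 1 : ℤ)), hlast _ _ (fun j => (x (.right j) + 1 : ℤ))]
  have htop : D.netFlow x .top =
      (x (.left 0) + x (.right 0) + 1 - x (.stem (Fin.last _)) : ℤ) := by
    rw [key]; simp; ring
  have hstem : ∀ i, D.netFlow x (.stem i) = (x (.stem (Fin.succ i)) + x (.stemZero i) + 1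
      - x (.stem (Fin.castSucc i)) : ℤ) := by
    intro i; rw [key]; simp; ring
  have hleft : ∀ i, D.netFlow x (.left i) = (x (.left (Fin.succ i)) + x (.leftZero i) + 1
      - x (.left (Fin.castSucc i)) : ℤ) := by
    intro i; rw [key]; simp; ring
  have hright : ∀ i, D.netFlow x (.right i) = (x (.right (Fin.succ i)) + x (.rightZero i) + 1
      - x (.right (Fin.castSucc i)) : ℤ) := by
    intro i; rw [key]; simp; ring
  constructor
  · intro h
    refine ⟨?_, fun i => ?_, fun i => ?_, fun i => ?_⟩
    · have := h .top; omega
    · have := h (.stem i); have := hstem i; omega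
    · have := h (.left i); have := hleft i; omega
    · have := h (.right i); have := hright i; omega
  · rintro ⟨h1, h2, h3, h4⟩
    have hne : ∀ v, v ≠ PeacockVertex.root → D.netFlow x v = 0 := by
      rintro (_ | _ | i | i | i) hv
      · exact absurd rfl hv
      · omega
      · have := h2 i; have := hstem i; omega
      · have := h3 i; have := hleft i; omega
      · have := h4 i; have := hright i; omega
    intro v
    by_cases hv : v = .root
    · rw [hv, ← D.sum_netFlow x]
      exact (Finset.sum_eq_single _ (fun w _ hw => hne w hw)
        fun h => absurd (Finset.mem_univ _) h).symm
    · exact hne v hv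

/-- A positive flow on a peacock diagram is given by the frequencies along the three chains. -/
def peacockFlowEquiv [DecidableEq (PeacockVertex m n k)] (α : Fin (m + 1) → ℕ)
    (β : Fin (n + 1) → ℕ) (γ : Fin (k + 1) → ℕ) :
    {x // (peacockOf α β γ).IsFlow x} ≃
      {t : (Fin (m + 1) → ℕ) × (Fin (n + 1) → ℕ) × (Fin (k + 1) → ℕ) //
        DescendsFrom ⊤ t.1 ∧ DescendsFrom ⊤ t.2.1 ∧ DescendsFrom ⊤ t.2.2 ∧
          t.2.1 0 + t.2.2 0 = t.1 (Fin.last m)} where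
  toFun x := ⟨(fun i => x.1 (.stem i) + 1, fun i => x.1 (.left i) + 1,
      fun i => x.1 (.right i) + 1), by
    obtain ⟨h1, h2, h3, h4⟩ := (isFlow_peacockOf_iff α β γ x.1).1 x.2
    simp only [descendsFrom_top_iff, Fin.strictAnti_iff_succ_lt]
    refine ⟨⟨fun i => Nat.succ_pos _, fun i => ?_⟩, ⟨fun i => Nat.succ_pos _, fun i => ?_⟩,
      ⟨fun i => Nat.succ_pos _, fun i => ?_⟩, ?_⟩
    · have := h2 i; omega
    · have := h3 i; omega
    · have := h4 i; omega
    · omega⟩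
  invFun t := ⟨fun
      | .stem i => t.1.1 i - 1
      | .left i => t.1.2.1 i - 1
      | .right i => t.1.2.2 i - 1
      -- The edge to the root carries what is lost between consecutive frequencies, positive because
      -- the chain strictly decreases; the final `- 1` undoes the shift.
      | .stemZero i => t.1.1 i.castSucc - t.1.1 i.succ - 1
      | .leftZero i => t.1.2.1 i.castSucc - t.1.2.1 i.succ - 1
      | .rightZero i => t.1.2.2 i.castSucc - t.1.2.2 i.succ - 1, by
    obtain ⟨⟨p, q, w⟩, h⟩ := t
    simp only [descendsFrom_top_iff, Fin.strictAnti_iff_succ_lt] at h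
    obtain ⟨⟨hp, hp'⟩, ⟨hq, hq'⟩, ⟨hw, hw'⟩, h⟩ := h
    rw [isFlow_peacockOf_iff]
    refine ⟨?_, fun i => ?_, fun i => ?_, fun i => ?_⟩ <;> dsimp only
    · have := hp (Fin.last m); have := hq 0; have := hw 0; omega
    · have := hp' i; have := hp i.succ; omega
    · have := hq' i; have := hq i.succ; omega
    · have := hw' i; have := hw i.succ; omega⟩
  left_inv x := by
    obtain ⟨h1, h2, h3, h4⟩ := (isFlow_peacockOf_iff α β γ x.1).1 x.2
    refine Subtype.ext (funext fun e => ?_)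
    rcases e with i | i | i | i | i | i <;> dsimp only
    · omega
    · omega
    · omega
    · have := h2 i; omega
    · have := h3 i; omega
    · have := h4 i; omega
  right_inv t := by
    obtain ⟨⟨p, q, w⟩, h⟩ := t
    refine Subtype.ext ?_
    dsimp only at h ⊢
    refine congrArg₂ _ (funext fun i => ?_) (congrArg₂ _ (funext fun i => ?_) (funext fun i => ?_))
    · have := h.1.1 i; omega
    · have := h.2.1.1 i; omega
    · have := h.2.2.1.1 i; omega

theorem ofReal_weight_peacockOf (α : Fin (m + 1) → ℕ)
    (β : Fin (n + 1) → ℕ) (γ : Fin (k + 1) → ℕ) (x : PeacockEdge m n k → ℕ) :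
    ENNReal.ofReal ((peacockOf α β γ).weight x) = (∏ i, invPow (α i) (x (.stem i) + 1)) *
      ((∏ i, invPow (β i) (x (.left i) + 1)) * ∏ i, invPow (γ i) (x (.right i) + 1)) := by
  rw [FeynmanDiagram.weight, ENNReal.ofReal_prod_of_nonneg fun i _ => by positivity,
    prod_peacockEdge]
  simp [peacockOf, invPow]

open Classical in
theorem flowSum_peacockOf [DecidableEq (PeacockVertex m n k)] (α : Fin (m + 1) → ℕ)
    (β : Fin (n + 1) → ℕ) (γ : Fin (k + 1) → ℕ) :
    (peacockOf α β γ).flowSum = ∑' (p : Fin (m + 1) → ℕ) (q : Fin (n + 1) → ℕ)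
      (w : Fin (k + 1) → ℕ), if DescendsFrom ⊤ p ∧ DescendsFrom ⊤ q ∧ DescendsFrom ⊤ w ∧
          q 0 + w 0 = p (Fin.last m) then (∏ i, invPow (α i) (p i)) *
      ((∏ i, invPow (β i) (q i)) * ∏ i, invPow (γ i) (w i)) else 0 := by
  simp only [FeynmanDiagram.flowSum, ofReal_weight_peacockOf]
  refine ((peacockFlowEquiv α β γ).tsum_eq fun t => (∏ i, invPow (α i) (t.1.1 i)) *
      ((∏ i, invPow (β i) (t.1.2.1 i)) * ∏ i, invPow (γ i) (t.1.2.2 i))).trans ?_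
  refine (tsum_subtype {t : (Fin (m + 1) → ℕ) × (Fin (n + 1) → ℕ) × (Fin (k + 1) → ℕ) |
        DescendsFrom ⊤ t.1 ∧ DescendsFrom ⊤ t.2.1 ∧ DescendsFrom ⊤ t.2.2 ∧
          t.2.1 0 + t.2.2 0 = t.1 (Fin.last m)} fun t => (∏ i, invPow (α i) (t.1 i)) *
      ((∏ i, invPow (β i) (t.2.1 i)) * ∏ i, invPow (γ i) (t.2.2 i))).trans ?_
  rw [ENNReal.tsum_prod']
  refine tsum_congr fun p => ?_
  rw [ENNReal.tsum_prod']
  exact tsum_congr fun q => tsum_congr fun w =>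
    (Set.indicator_apply _ _ _).trans (if_congr Iff.rfl rfl rfl)

end Flow

/-! ### Peacock integrals as nested sums -/

theorem peacock_cons (a₀ b₀ c₀ : ℕ) (a b c : List ℕ) :
    peacock (a₀ :: a) (b₀ :: b) (c₀ :: c) =
      peacockOf (a₀ :: a).get (b₀ :: b).get (c₀ :: c).get := by
  unfold peacock peacockOf
  congr 1 <;> funext e <;> rcases e with i | i | i | i | i | i <;>
    first | rfl | exact List.getD_eq_getElem (l := _ :: _) _ i.2

theorem flowSum_peacockOf_get (a₀ b₀ c₀ : ℕ) (a b c : List ℕ)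
    [DecidableEq (PeacockVertex a.length b.length c.length)] :
    (peacockOf (a₀ :: a).get (b₀ :: b).get (c₀ :: c).get).flowSum =
      peacockSum (a₀ :: a) (b₀ :: b) (c₀ :: c) := by
  classical
  rw [peacockSum, chainSum_eq_tsum]
  refine (flowSum_peacockOf _ _ _).trans (tsum_congr fun p => ?_)
  split_ifs with hp
  · rw [lastFrom_succ, featherPairSum_eq_tsum, ← ENNReal.tsum_mul_left]
    refine tsum_congr fun q => ?_
    rw [← ENNReal.tsum_mul_left]
    refine tsum_congr fun w => ?_
    simp only [hp, true_and, mul_ite, mul_zero]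
    exact if_congr Iff.rfl rfl rfl
  · simp [hp]

theorem peacockConverges_iff {a b c : List ℕ} (ha : a ≠ []) (hb : b ≠ []) (hc : c ≠ []) :
    PeacockConverges a b c ↔ peacockSum a b c ≠ ⊤ := by
  classical
  obtain ⟨a₀, a, rfl⟩ := List.exists_cons_of_ne_nil ha
  obtain ⟨b₀, b, rfl⟩ := List.exists_cons_of_ne_nil hb
  obtain ⟨c₀, c, rfl⟩ := List.exists_cons_of_ne_nil hc
  rw [PeacockConverges, peacock_cons, ← flowSum_peacockOf_get]
  exact FeynmanDiagram.converges_iff _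

theorem peacockZ_eq {a b c : List ℕ} (ha : a ≠ []) (hb : b ≠ []) (hc : c ≠ [])
    (h : peacockSum a b c ≠ ⊤) : peacockZ a b c = ((peacockSum a b c).toReal : ℂ) := by
  classical
  obtain ⟨a₀, a, rfl⟩ := List.exists_cons_of_ne_nil ha
  obtain ⟨b₀, b, rfl⟩ := List.exists_cons_of_ne_nil hb
  obtain ⟨c₀, c, rfl⟩ := List.exists_cons_of_ne_nil hc
  rw [← flowSum_peacockOf_get] at h ⊢
  rw [peacockZ, peacock_cons]
  exact FeynmanDiagram.value_eq _ h

/-! ### Pascal sums -/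

/-- The sum of `f` along a diagonal with binomial weights. -/
def pascalSum {M : Type*} [AddCommMonoid M] (f : ℕ → ℕ → M) (p q : ℕ) : M :=
  ∑ j ∈ Finset.range (q + 1), (p + j).choose j • f (p + j) (q - j)

section Pascal

variable {M : Type*} [AddCommMonoid M] (f : ℕ → ℕ → M)

theorem pascalSum_zero_right (p : ℕ) : pascalSum f p 0 = f p 0 := by simp [pascalSum]

theorem pascalSum_zero_succ {T : M →+ M} (hT : ∀ i l, T (f i l) = f (i + 1) l) (q : ℕ) :
    pascalSum f 0 (q + 1) = f 0 (q + 1) + T (pascalSum f 0 q) := by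
  rw [pascalSum, Finset.sum_range_succ', add_comm, pascalSum, map_sum]
  congr 1
  · simp
  · refine Finset.sum_congr rfl fun j _ => ?_
    simp [hT]

/-- Pascal's rule for the binomial weights. The operator `T` will be multiplication by `S` for
partial fractions and prepending a letter for shuffles. -/
theorem pascalSum_succ_succ {T : M →+ M} (hT : ∀ i l, T (f i l) = f (i + 1) l) (p q : ℕ) :
    pascalSum f (p + 1) (q + 1) = T (pascalSum f p (q + 1)) + T (pascalSum f (p + 1) q) := by
  simp only [pascalSum, map_sum, map_nsmul, hT]
  rw [Finset.sum_range_succ' _ (q + 1), Finset.sum_range_succ' _ (q + 1),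
    add_right_comm (Finset.sum _ _),
    ← Finset.sum_add_distrib]
  congr 1
  · refine Finset.sum_congr rfl fun j _ => ?_
    have h : p + 1 + (j + 1) = p + (j + 1) + 1 := by ring
    have h' : p + 1 + j = p + (j + 1) := by ring
    rw [h, h', Nat.choose_succ_succ, add_smul, Nat.add_sub_add_right, add_comm]
  · simp

/-- Substitute `j = q + 1 - ν` and use the symmetry of binomial coefficients; labels are lowered by
one. -/
theorem sum_Icc_choose_eq_pascalSum (g : ℕ → ℕ → M) {p q N : ℕ} (hN : N = p + q + 2) :
    ∑ ν ∈ Finset.Icc 1 (q + 1), (N - ν - 1).choose p • g (N - ν) ν =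
      pascalSum (fun i l => g (i + 1) (l + 1)) p q := by
  rw [pascalSum]
  refine Finset.sum_nbij' (fun ν => q + 1 - ν) (fun j => q + 1 - j) ?_ ?_ ?_ ?_ ?_
  · intro ν hν; simp only [Finset.mem_Icc, Finset.mem_range] at *; omega
  · intro ν hν; simp only [Finset.mem_Icc, Finset.mem_range] at *; omega
  · intro ν hν; simp only [Finset.mem_Icc] at *; omega
  · intro ν hν; simp only [Finset.mem_range] at *; omega
  · intro ν hν
    simp only [Finset.mem_Icc] at hν
    have h1 : N - ν - 1 = p + (q + 1 - ν) := by omega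
    have h2 : N - ν = p + (q + 1 - ν) + 1 := by omega
    have h3 : q - (q + 1 - ν) + 1 = ν := by omega
    rw [h1, h2, h3, Nat.choose_symm_add]

end Pascal

/-- The partial fraction expansion of `X ^ (q + 1) * Y ^ (p + 1)` when `X = 1 / x`, `Y = 1 / y` and
`S = 1 / (x + y)`. -/
theorem pow_mul_pow_eq_pascalSum {R : Type*} [CommSemiring R] {X Y S : R}
    (h : X * Y = S * X + S * Y) (p q : ℕ) :
    X ^ (q + 1) * Y ^ (p + 1) = pascalSum (fun i l => S ^ (i + 1) * X ^ (l + 1)) p q +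
      pascalSum (fun i l => S ^ (i + 1) * Y ^ (l + 1)) q p := by
  have hT : ∀ Z : R, ∀ i l, AddMonoidHom.mulLeft S (S ^ (i + 1) * Z ^ (l + 1)) =
      S ^ (i + 1 + 1) * Z ^ (l + 1) := fun Z i l => by
    rw [AddMonoidHom.coe_mulLeft, ← mul_assoc, ← pow_succ']
  induction p generalizing q with
  | zero =>
    induction q with
    | zero => simpa [pascalSum] using h
    | succ q ih =>
      rw [pascalSum_zero_succ _ (hT X), pascalSum_zero_right]
      have ih' := congrArg (S * ·) ih
      simp only [mul_add, pascalSum_zero_right] at ih'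
      simp only [AddMonoidHom.coe_mulLeft]
      calc X ^ (q + 1 + 1) * Y ^ (0 + 1) = X ^ (q + 1) * (X * Y) := by ring
        _ = S * X ^ (q + 1 + 1) + S * (X ^ (q + 1) * Y ^ (0 + 1)) := by rw [h]; ring
        _ = _ := by rw [ih']; ring
  | succ p ihp =>
    induction q with
    | zero =>
      rw [pascalSum_zero_succ _ (hT Y), pascalSum_zero_right]
      have ih' := congrArg (S * ·) (ihp 0)
      simp only [mul_add, pascalSum_zero_right] at ih'
      simp only [AddMonoidHom.coe_mulLeft]
      calc X ^ (0 + 1) * Y ^ (p + 1 + 1) = Y ^ (p + 1) * (X * Y) := by ring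
        _ = S * Y ^ (p + 1 + 1) + S * (X ^ (0 + 1) * Y ^ (p + 1)) := by rw [h]; ring
        _ = _ := by rw [ih']; ring
    | succ q ihq =>
      rw [pascalSum_succ_succ _ (hT X), pascalSum_succ_succ _ (hT Y)]
      simp only [AddMonoidHom.coe_mulLeft]
      -- One factor `X * Y` is expanded by `h`; each resulting term has one exponent lowered and
      -- falls under one of the two inductions.
      calc X ^ (q + 1 + 1) * Y ^ (p + 1 + 1) = X ^ (q + 1) * Y ^ (p + 1) * (X * Y) := by ring
        _ = S * (X ^ (q + 1 + 1) * Y ^ (p + 1)) + S * (X ^ (q + 1) * Y ^ (p + 1 + 1)) := by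
          rw [h]; ring
        _ = _ := by rw [ihq, ihp]; ring

/-! ### The shuffle product -/

section Shuffle

variable {α : Type}

theorem wordShuffle_nil_left (w : List α) : wordShuffle [] w = {w} := by
  rw [wordShuffle]

theorem wordShuffle_nil_right (w : List α) : wordShuffle w [] = {w} := by
  cases w with
  | nil => rw [wordShuffle]
  | cons x v => rw [wordShuffle]; simp

theorem wordShuffle_cons_cons (x y : α) (v w : List α) :
    wordShuffle (x :: v) (y :: w) = (wordShuffle v (y :: w)).map (fun s => x :: s) +
      (wordShuffle (x :: v) w).map (fun s => y :: s) := by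
  rw [wordShuffle]

/-- The shuffle product, sorted by the first occurrence of the letter `y`. -/
theorem wordShuffle_replicate (x y : α) (v w : List α) (p q : ℕ) :
    wordShuffle (List.replicate p x ++ y :: v) (List.replicate q x ++ y :: w) =
      pascalSum (fun i l => (wordShuffle v (List.replicate l x ++ y :: w)).map
        fun s => List.replicate i x ++ y :: s) p q +
      pascalSum (fun i l => (wordShuffle (List.replicate l x ++ y :: v) w).map
        fun s => List.replicate i x ++ y :: s) q p := by
  -- Prepending `x` is the operator of the Pascal recursion: it lengthens the block before the first
  -- `y`.
  have hT : ∀ F : ℕ → Multiset (List α), ∀ i l,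
      Multiset.mapAddMonoidHom (List.cons x) ((F l).map fun s => List.replicate i x ++ y :: s) =
        (F l).map fun s => List.replicate (i + 1) x ++ y :: s := fun F i l => by
    simp [List.replicate_succ]
  have hT1 := hT fun l => wordShuffle v (List.replicate l x ++ y :: w)
  have hT2 := hT fun l => wordShuffle (List.replicate l x ++ y :: v) w
  induction p generalizing q with
  | zero =>
    induction q with
    | zero => simp [pascalSum, wordShuffle_cons_cons]
    | succ q ih =>
      rw [pascalSum_zero_succ _ hT1, pascalSum_zero_right, ← hT2, List.replicate_succ,
        List.replicate_zero, List.nil_append, List.cons_append, wordShuffle_cons_cons, add_assoc,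
        ← map_add]
      rw [pascalSum_zero_right] at ih
      simp only [List.replicate_zero, List.nil_append] at ih ⊢
      rw [← ih]
      rfl
  | succ p ihp =>
    induction q with
    | zero =>
      have ih := ihp 0
      rw [pascalSum_zero_right] at ih
      rw [pascalSum_zero_succ _ hT2, pascalSum_zero_right, ← hT1, add_left_comm, ← map_add, ← ih,
        List.replicate_succ, List.replicate_zero, List.nil_append, List.cons_append,
        wordShuffle_cons_cons, add_comm]
      simp
    | succ q ihq =>
      have h : wordShuffle (List.replicate (p + 1) x ++ y :: v)
          (List.replicate (q + 1) x ++ y :: w) =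
          Multiset.mapAddMonoidHom (List.cons x) (wordShuffle (List.replicate p x ++ y :: v)
            (List.replicate (q + 1) x ++ y :: w)) +
          Multiset.mapAddMonoidHom (List.cons x) (wordShuffle (List.replicate (p + 1) x ++ y :: v)
            (List.replicate q x ++ y :: w)) := by
        rw [List.replicate_succ, List.replicate_succ, List.cons_append, List.cons_append,
          wordShuffle_cons_cons]
        rfl
      rw [pascalSum_succ_succ _ hT1, pascalSum_succ_succ _ hT2, h, ihp, ihq, map_add, map_add]
      abel

end Shuffle

/-! ### The peacock expansion and its words -/

theorem zetaWord_cons (k : ℕ) (ks : List ℕ) :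
    zetaWord ((k + 1) :: ks) = List.replicate k .x₀ ++ .x₁ :: zetaWord ks := by
  simp [zetaWord]

theorem zetaWord_append (a b : List ℕ) : zetaWord (a ++ b) = zetaWord a ++ zetaWord b := by
  simp [zetaWord]

theorem peacockExpansion_nil_left (d c : List ℕ) : peacockExpansion d [] c = {d ++ c} := by
  rw [peacockExpansion]

theorem peacockExpansion_nil_right (d b : List ℕ) : peacockExpansion d b [] = {d ++ b} := by
  cases b with
  | nil => rw [peacockExpansion]
  | cons x v => rw [peacockExpansion]; simp

theorem peacockExpansion_cons_cons (d b c : List ℕ) (p q : ℕ) :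
    peacockExpansion d ((q + 1) :: b) ((p + 1) :: c) =
      pascalSum (fun i l => peacockExpansion (d ++ [i + 1]) ((l + 1) :: b) c) p q +
      pascalSum (fun i l => peacockExpansion (d ++ [i + 1]) b ((l + 1) :: c)) q p := by
  rw [peacockExpansion, ← sum_Icc_choose_eq_pascalSum
    (fun k ν => peacockExpansion (d ++ [k]) (ν :: b) c) (N := q + 1 + (p + 1)) (by ring),
    ← sum_Icc_choose_eq_pascalSum
    (fun k ν => peacockExpansion (d ++ [k]) b (ν :: c)) (N := q + 1 + (p + 1)) (by ring)]
  simp only [Nat.add_sub_cancel]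

theorem map_pascalSum {M N : Type*} [AddCommMonoid M] [AddCommMonoid N] (T : M →+ N)
    (f : ℕ → ℕ → M) (p q : ℕ) : T (pascalSum f p q) = pascalSum (fun i l => T (f i l)) p q := by
  simp [pascalSum]

theorem positiveIndex_cons {k : ℕ} {ks : List ℕ} :
    PositiveIndex (k :: ks) ↔ 1 ≤ k ∧ PositiveIndex ks := List.forall_mem_cons

/-- Induction along the recursion of `peacockExpansion`, for positive indices. -/
theorem positiveIndex_pair_induction {P : List ℕ → List ℕ → Prop}
    (nil_left : ∀ c, PositiveIndex c → P [] c) (nil_right : ∀ b, PositiveIndex b → P b [])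
    (cons_cons : ∀ b c p q, PositiveIndex b → PositiveIndex c → (∀ l, P ((l + 1) :: b) c) →
      (∀ l, P b ((l + 1) :: c)) → P ((q + 1) :: b) ((p + 1) :: c))
    (b c : List ℕ) (hb : PositiveIndex b) (hc : PositiveIndex c) : P b c := by
  -- The leading entry may become any positive number, but every step removes one entry, so the
  -- total length is what decreases.
  induction hn : b.length + c.length using Nat.strong_induction_on generalizing b c with
  | _ n ih =>
    match b, c, hb, hc with
    | [], c, _, hc => exact nil_left c hc
    | b, [], hb, _ => exact nil_right b hb
    | b₁ :: b, c₁ :: c, hb, hc =>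
      rw [positiveIndex_cons] at hb hc
      obtain ⟨q, rfl⟩ := Nat.exists_eq_add_of_le' hb.1
      obtain ⟨p, rfl⟩ := Nat.exists_eq_add_of_le' hc.1
      simp only [List.length_cons] at hn
      refine cons_cons b c p q hb.2 hc.2 (fun l => ?_) fun l => ?_
      · exact ih _ (by simp only [List.length_cons]; omega) _ _
          (positiveIndex_cons.2 ⟨Nat.le_add_left _ _, hb.2⟩) hc.2 rfl
      · exact ih _ (by simp only [List.length_cons]; omega) _ _ hb.2
          (positiveIndex_cons.2 ⟨Nat.le_add_left _ _, hc.2⟩) rfl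

/-- Sorting the shuffle by the first `x₁` gives the recursion of the expansion; the prefix `d`
accumulates the blocks already produced. -/
theorem map_zetaWord_peacockExpansion (b c : List ℕ) (hb : PositiveIndex b)
    (hc : PositiveIndex c) (d : List ℕ) :
    (peacockExpansion d b c).map zetaWord =
      (wordShuffle (zetaWord b) (zetaWord c)).map fun s => zetaWord d ++ s := by
  revert d
  refine positiveIndex_pair_induction (P := fun b c => ∀ d, (peacockExpansion d b c).map zetaWord =
      (wordShuffle (zetaWord b) (zetaWord c)).map fun s => zetaWord d ++ s) ?_ ?_ ?_ b c hb hc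
  · intro c _ d
    simp [peacockExpansion_nil_left, wordShuffle_nil_left, zetaWord]
  · intro c _ d
    simp [peacockExpansion_nil_right, wordShuffle_nil_right, zetaWord]
  · intro b c p q _ _ ih1 ih2 d
    rw [peacockExpansion_cons_cons, zetaWord_cons, zetaWord_cons, wordShuffle_replicate,
      add_comm (pascalSum _ q p)]
    simp only [← Multiset.coe_mapAddMonoidHom, map_add, map_pascalSum]
    simp only [Multiset.coe_mapAddMonoidHom, ih1, ih2, zetaWord_append, zetaWord_cons,
      Multiset.map_map, Function.comp_def]
    simp [zetaWord]

/-- Each step emits one entry and preserves the weight, as the indices run along a diagonal. The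
first emitted entry is at least one of the two leading entries, so it is at least 2 when both are.
-/
theorem peacockExpansion_mem (b c : List ℕ) (hb : PositiveIndex b)
    (hc : PositiveIndex c) (d : List ℕ) : ∀ s ∈ peacockExpansion d b c, ∃ t, s = d ++ t ∧
      PositiveIndex t ∧ t.length = b.length + c.length ∧ t.sum = b.sum + c.sum ∧
      (2 ≤ b.headD 0 → 2 ≤ c.headD 0 → 2 ≤ t.headD 0) := by
  revert d
  refine positiveIndex_pair_induction (P := fun b c => ∀ d, ∀ s ∈ peacockExpansion d b c,
    ∃ t, s = d ++ t ∧ PositiveIndex t ∧ t.length = b.length + c.length ∧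
      t.sum = b.sum + c.sum ∧ (2 ≤ b.headD 0 → 2 ≤ c.headD 0 → 2 ≤ t.headD 0)) ?_ ?_ ?_ b c hb hc
  · intro c hc d s hs
    rw [peacockExpansion_nil_left, Multiset.mem_singleton] at hs
    exact ⟨c, hs, hc, by simp, by simp, by simp⟩
  · intro b hb d s hs
    rw [peacockExpansion_nil_right, Multiset.mem_singleton] at hs
    exact ⟨b, hs, hb, by simp, by simp, by simp⟩
  · intro b c p q _ _ ih1 ih2 d s hs
    rw [peacockExpansion_cons_cons, Multiset.mem_add, pascalSum, pascalSum, Multiset.mem_sum,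
      Multiset.mem_sum] at hs
    rcases hs with ⟨j, hj, hs⟩ | ⟨j, hj, hs⟩ <;> rw [Finset.mem_range] at hj <;>
      replace hs := Multiset.mem_of_mem_nsmul hs
    · obtain ⟨t, rfl, ht, hl, hsum, -⟩ := ih1 _ _ _ hs
      refine ⟨(p + j + 1) :: t, by simp, positiveIndex_cons.2 ⟨Nat.le_add_left _ _, ht⟩, ?_, ?_, ?_⟩
      · simp only [List.length_cons] at *; omega
      · simp only [List.sum_cons] at *; omega
      · simp only [List.headD_cons]; omega
    · obtain ⟨t, rfl, ht, hl, hsum, -⟩ := ih2 _ _ _ hs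
      refine ⟨(q + j + 1) :: t, by simp, positiveIndex_cons.2 ⟨Nat.le_add_left _ _, ht⟩, ?_, ?_, ?_⟩
      · simp only [List.length_cons] at *; omega
      · simp only [List.sum_cons] at *; omega
      · simp only [List.headD_cons]; omega

/-! ### Rules for peacock sums -/

theorem featherPairSum_comm (b c : List ℕ) (N : ℕ∞) :
    featherPairSum b c N = featherPairSum c b N := by
  rw [featherPairSum, ENNReal.tsum_comm]
  refine tsum_congr fun q => tsum_congr fun p => ?_
  rw [add_comm p q, mul_comm]
  exact if_congr (by tauto) rfl rfl

theorem peacockSum_comm (a b c : List ℕ) : peacockSum a b c = peacockSum a c b := by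
  rw [peacockSum, peacockSum, funext (featherPairSum_comm b c)]

theorem chainSum_singleton (k : ℕ) (g : ℕ∞ → ℝ≥0∞) (M : ℕ∞) :
    chainSum [k] g M = ∑' n : ℕ, if 0 < n ∧ (n : ℕ∞) < M then invPow k n * g n else 0 := rfl

theorem chainSum_one_eq {b : List ℕ} (hb : b ≠ []) (M : ℕ∞) :
    chainSum b (fun _ => 1) M =
      ∑' p : ℕ, if 0 < p ∧ (p : ℕ∞) < M then featherSum b p else 0 := by
  obtain ⟨b₀, b, rfl⟩ := List.exists_cons_of_ne_nil hb
  rfl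

theorem featherSum_zero_cons {b : List ℕ} (p : ℕ) :
    featherSum (0 :: b) p = chainSum b (fun _ => 1) p := by
  simp [featherSum]

/-- The feather with the single label 0 has weight 1 and takes the frequency `N - q`; only `q < N`
remains as a condition. -/
theorem featherPairSum_zero {b : List ℕ} (hb : b ≠ []) (N : ℕ) :
    featherPairSum [0] b N = chainSum b (fun _ => 1) N := by
  rw [featherPairSum, ENNReal.tsum_comm, chainSum_one_eq hb]
  refine tsum_congr fun q => ?_
  simp only [featherSum_zero_cons, chainSum, one_mul, Nat.cast_inj, Nat.cast_lt]
  rw [tsum_eq_single (N - q)]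
  · exact if_congr (by omega) rfl rfl
  · intro p hp
    exact if_neg (by omega)

/-- Both sides are the sum over `p' + q < N`: on the left the frequency of the label 0 is determined
as `N - q`, on the right the new stem frequency as `p' + q`. -/
theorem featherPairSum_zero_cons {b : List ℕ} (hb : b ≠ []) (c : List ℕ) (N : ℕ) :
    featherPairSum (0 :: b) c N = chainSum [0] (featherPairSum b c) N := by
  have hL : featherPairSum (0 :: b) c N = ∑' (p' : ℕ) (q : ℕ),
      if 0 < p' ∧ 0 < q ∧ p' + q < N then featherSum b p' * featherSum c q else 0 := by
    have h1 : featherPairSum (0 :: b) c N = ∑' (p : ℕ) (q : ℕ) (p' : ℕ),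
        if (0 < p ∧ 0 < q ∧ p + q = N) ∧ 0 < p' ∧ p' < p then
          featherSum b p' * featherSum c q else 0 := by
      refine tsum_congr fun p => tsum_congr fun q => ?_
      simp only [featherSum_zero_cons, chainSum_one_eq hb, Nat.cast_inj]
      split_ifs with h
      · rw [← ENNReal.tsum_mul_right]
        refine tsum_congr fun p' => ?_
        simp only [h, and_self, true_and, Nat.cast_lt, ite_mul, zero_mul]
      · simp [h]
    rw [h1, ENNReal.tsum_comm]
    refine Eq.trans (tsum_congr fun q => ENNReal.tsum_comm) ?_
    rw [ENNReal.tsum_comm]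
    refine tsum_congr fun p' => tsum_congr fun q => ?_
    rw [tsum_eq_single (N - q)]
    · exact if_congr (by omega) rfl rfl
    · intro p hp
      exact if_neg (by omega)
  have hR : chainSum [0] (featherPairSum b c) N = ∑' (p' : ℕ) (q : ℕ),
      if 0 < p' ∧ 0 < q ∧ p' + q < N then featherSum b p' * featherSum c q else 0 := by
    have h1 : chainSum [0] (featherPairSum b c) N = ∑' (n : ℕ) (p' : ℕ) (q : ℕ),
        if (0 < n ∧ n < N) ∧ 0 < p' ∧ 0 < q ∧ p' + q = n then
          featherSum b p' * featherSum c q else 0 := by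
      rw [chainSum_singleton]
      refine tsum_congr fun n => ?_
      simp only [featherPairSum, Nat.cast_inj, Nat.cast_lt, invPow_zero, one_mul]
      split_ifs with h <;> simp [h]
    rw [h1, ENNReal.tsum_comm]
    refine tsum_congr fun p' => ?_
    rw [ENNReal.tsum_comm]
    refine tsum_congr fun q => ?_
    rw [tsum_eq_single (p' + q)]
    · exact if_congr (by omega) rfl rfl
    · intro n hn
      exact if_neg (by omega)
  rw [hL, hR]

theorem peacockSum_zero_cons {a b : List ℕ} (ha : a ≠ []) (hb : b ≠ []) (c : List ℕ) :
    peacockSum a (0 :: b) c = peacockSum (a ++ [0]) b c := by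
  rw [peacockSum, peacockSum, chainSum_append]
  exact chainSum_congr ha (fun n _ => featherPairSum_zero_cons hb c n) _

theorem peacockSum_zero {a b : List ℕ} (ha : a ≠ []) (hb : b ≠ []) :
    peacockSum a [0] b = chainSum (a ++ b) (fun _ => 1) ⊤ := by
  rw [peacockSum, chainSum_append]
  exact chainSum_congr ha (fun n _ => featherPairSum_zero hb n) _

/-- Summing over the weightless stem frequency removes the constraint `p + q = n`, so the feathers
become independent. -/
theorem peacockSum_zero_stem {a b : List ℕ} (ha : a ≠ []) (hb : b ≠ []) :
    peacockSum [0] a b = chainSum a (fun _ => 1) ⊤ * chainSum b (fun _ => 1) ⊤ := by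
  rw [peacockSum, chainSum_singleton, chainSum_one_eq ha, chainSum_one_eq hb,
    ← ENNReal.tsum_mul_right]
  have h1 : ∀ n : ℕ, (if 0 < n ∧ (n : ℕ∞) < ⊤ then invPow 0 n * featherPairSum a b n else 0) =
      ∑' (p : ℕ) (q : ℕ), if (0 < n) ∧ 0 < p ∧ 0 < q ∧ p + q = n then
        featherSum a p * featherSum b q else 0 := by
    intro n
    simp only [featherPairSum, Nat.cast_inj, ENat.natCast_lt_top, and_true, invPow_zero, one_mul]
    split_ifs with h <;> simp [h]
  simp only [h1]
  rw [ENNReal.tsum_comm]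
  refine tsum_congr fun p => ?_
  rw [ENNReal.tsum_comm, ← ENNReal.tsum_mul_left]
  refine tsum_congr fun q => ?_
  rw [tsum_eq_single (p + q) fun n hn => if_neg (by omega)]
  by_cases hp : 0 < p <;> by_cases hq : 0 < q <;> simp [hp, hq]

/-- Excludes `0 * ⊤ = 0`, so that finiteness of a product yields finiteness of both factors. -/
theorem chainSum_one_ne_zero (k : List ℕ) : chainSum k (fun _ => 1) ⊤ ≠ 0 := by
  rw [← tsum_ofReal_mzvTerm, Ne, ENNReal.tsum_eq_zero, not_forall]
  -- The chain `m > m - 1 > ⋯ > 1`, with `m` the length of `k`, gives a positive term.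
  refine ⟨⟨fun i => k.length - (i : ℕ), fun i j h => ?_, fun i => Nat.sub_pos_of_lt i.2⟩, ?_⟩
  · exact Nat.sub_lt_sub_left i.2 h
  · rw [ENNReal.ofReal_eq_zero, not_le]
    exact mzvTerm_pos _ _

theorem chainSum_add (a : List ℕ) (g h : ℕ∞ → ℝ≥0∞) (M : ℕ∞) :
    chainSum a (fun N => g N + h N) M = chainSum a g M + chainSum a h M := by
  induction a generalizing M with
  | nil => rfl
  | cons k a ih =>
    simp only [chainSum, ih, ← ENNReal.tsum_add]
    refine tsum_congr fun n => ?_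
    split_ifs
    · rw [mul_add]
    · rw [add_zero]

theorem chainSum_sum {ι : Type*} (s : Finset ι) (C : ι → ℕ) (a : List ℕ)
    (g : ι → ℕ∞ → ℝ≥0∞) (M : ℕ∞) :
    chainSum a (fun N => ∑ i ∈ s, C i • g i N) M = ∑ i ∈ s, C i • chainSum a (g i) M := by
  induction a generalizing M with
  | nil => rfl
  | cons k a ih =>
    simp only [chainSum, ih]
    simp only [nsmul_eq_mul, ← ENNReal.tsum_mul_left]
    rw [← Summable.tsum_finsetSum fun _ _ => ENNReal.summable]
    refine tsum_congr fun n => ?_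
    split_ifs
    · rw [Finset.mul_sum]
      exact Finset.sum_congr rfl fun i _ => by ring
    · simp

theorem invPow_eq_pow (k n : ℕ) : invPow k n = invPow 1 n ^ k := by
  rw [invPow, invPow, ← ENNReal.ofReal_pow (by positivity)]
  simp

theorem invPow_one_mul_invPow_one {x y : ℕ} (hx : 0 < x) (hy : 0 < y) :
    invPow 1 x * invPow 1 y = invPow 1 (x + y) * invPow 1 x + invPow 1 (x + y) * invPow 1 y := by
  simp only [invPow]
  rw [← ENNReal.ofReal_mul (by positivity), ← ENNReal.ofReal_mul (by positivity),
    ← ENNReal.ofReal_mul (by positivity), ← ENNReal.ofReal_add (by positivity) (by positivity)]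
  congr 1
  push_cast
  field_simp
  ring

theorem invPow_mul_invPow {x y : ℕ} (hx : 0 < x) (hy : 0 < y) (p q : ℕ) :
    invPow (q + 1) x * invPow (p + 1) y =
      pascalSum (fun i l => invPow (i + 1) (x + y) * invPow (l + 1) x) p q +
      pascalSum (fun i l => invPow (i + 1) (x + y) * invPow (l + 1) y) q p := by
  have := pow_mul_pow_eq_pascalSum (invPow_one_mul_invPow_one hx hy) p q
  simpa only [← invPow_eq_pow] using this

/-- Partial fractions in the first frequencies `x + y = N`. In each term one of the two leading
labels becomes 0, and the power of `1 / N` no longer depends on the feathers. -/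
theorem featherPairSum_cons_cons (b c : List ℕ) (p q N : ℕ) :
    featherPairSum ((q + 1) :: b) ((p + 1) :: c) N =
      pascalSum (fun i l => invPow (i + 1) N * featherPairSum ((l + 1) :: b) (0 :: c) N) p q +
      pascalSum (fun i l => invPow (i + 1) N * featherPairSum (0 :: b) ((l + 1) :: c) N) q p := by
  simp only [pascalSum, featherPairSum, nsmul_eq_mul, ← ENNReal.tsum_mul_left]
  simp only [← Summable.tsum_finsetSum fun _ _ => ENNReal.summable, ← ENNReal.tsum_add]
  refine tsum_congr fun x => tsum_congr fun y => ?_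
  split_ifs with h
  · obtain ⟨hx, hy, h⟩ := h
    rw [Nat.cast_inj] at h
    subst h
    have key := invPow_mul_invPow hx hy p q
    simp only [pascalSum, nsmul_eq_mul] at key
    simp only [featherSum, invPow_zero, one_mul]
    calc _ = (invPow (q + 1) x * invPow (p + 1) y) *
          (chainSum b (fun _ => 1) x * chainSum c (fun _ => 1) y) := by ring
      _ = _ := by
        rw [key, add_mul, Finset.sum_mul, Finset.sum_mul]
        congr 1 <;> exact Finset.sum_congr rfl fun i _ => by ring
  · simp

/-- The power of `1 / N` split off from the feathers becomes the label of the last stem propagator,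
which had order 0. -/
theorem peacockSum_partial (a b c : List ℕ) (p q : ℕ) :
    peacockSum (a ++ [0]) ((q + 1) :: b) ((p + 1) :: c) =
      pascalSum (fun i l => peacockSum (a ++ [i + 1]) ((l + 1) :: b) (0 :: c)) p q +
      pascalSum (fun i l => peacockSum (a ++ [i + 1]) (0 :: b) ((l + 1) :: c)) q p := by
  simp only [peacockSum, chainSum_append, pascalSum]
  rw [← chainSum_sum, ← chainSum_sum, ← chainSum_add]
  congr 1
  funext M
  simp only [chainSum_singleton, nsmul_eq_mul, ← ENNReal.tsum_mul_left]
  simp only [← Summable.tsum_finsetSum fun _ _ => ENNReal.summable, ← ENNReal.tsum_add]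
  refine tsum_congr fun n => ?_
  split_ifs
  · rw [invPow_zero, one_mul, featherPairSum_cons_cons]
    simp only [pascalSum, nsmul_eq_mul]
  · simp

/-- After partial integration one feather starts with 0. If nothing follows, the diagram is a single
nested sum; otherwise the exchange rule moves the 0 to the end of the stem, where induction applies.
-/
theorem peacockSum_eq_sum_expansion {b c : List ℕ} (hb : PositiveIndex b)
    (hc : PositiveIndex c) (hb' : b ≠ []) (hc' : c ≠ []) (d : List ℕ) :
    peacockSum (d ++ [0]) b c =
      ((peacockExpansion d b c).map fun s => chainSum s (fun _ => 1) ⊤).sum := by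
  revert hb' hc' d
  refine positiveIndex_pair_induction (P := fun b c => b ≠ [] → c ≠ [] → ∀ d,
    peacockSum (d ++ [0]) b c =
      ((peacockExpansion d b c).map fun s => chainSum s (fun _ => 1) ⊤).sum) ?_ ?_ ?_ b c hb hc
  · exact fun c _ h => absurd rfl h
  · exact fun b _ _ h => absurd rfl h
  · intro b c p q _ _ ih1 ih2 _ _ d
    have h1 : ∀ i l, peacockSum (d ++ [i + 1]) ((l + 1) :: b) (0 :: c) =
        ((peacockExpansion (d ++ [i + 1]) ((l + 1) :: b) c).map
          fun s => chainSum s (fun _ => 1) ⊤).sum := by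
      intro i l
      rw [peacockSum_comm]
      rcases eq_or_ne c [] with rfl | hc
      · rw [peacockSum_zero (by simp) (by simp), peacockExpansion_nil_right]
        simp
      · rw [peacockSum_zero_cons (by simp) hc, peacockSum_comm, ih1 l (by simp) hc]
    have h2 : ∀ i l, peacockSum (d ++ [i + 1]) (0 :: b) ((l + 1) :: c) =
        ((peacockExpansion (d ++ [i + 1]) b ((l + 1) :: c)).map
          fun s => chainSum s (fun _ => 1) ⊤).sum := by
      intro i l
      rcases eq_or_ne b [] with rfl | hb
      · rw [peacockSum_zero (by simp) (by simp), peacockExpansion_nil_left]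
        simp
      · rw [peacockSum_zero_cons (by simp) hb, ih2 l hb (by simp)]
    rw [peacockSum_partial, peacockExpansion_cons_cons]
    simp only [h1, h2]
    have h3 := map_pascalSum (Multiset.sumAddMonoidHom.comp
      (Multiset.mapAddMonoidHom fun s => chainSum s (fun _ => 1) ⊤))
    simp only [AddMonoidHom.comp_apply, Multiset.coe_mapAddMonoidHom,
      Multiset.coe_sumAddMonoidHom] at h3
    rw [Multiset.map_add, Multiset.sum_add, h3, h3]

/-! ### Convergence for admissible indices -/

/-- The largest variable has a spare factor `1 / n₁`. Splitting it into `m` equal powers and using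
`n i ≤ n₁` bounds the term by a product of convergent series with exponent `1 + 1 / m`. -/
theorem AdmissibleIndex.summable_mzvTerm {k : List ℕ} (hk : AdmissibleIndex k) :
    Summable (mzvTerm k) := by
  obtain ⟨hpos, h2⟩ := hk
  obtain _ | ⟨k₀, ks⟩ := k
  · simp at h2
  set m := ks.length + 1 with hm
  set t : ℝ := 1 / m with ht
  have hm0 : (0 : ℝ) < m := by positivity
  have ht0 : 0 < t := by positivity
  have hs : Summable fun x : Fin m → ℕ => ∏ i, ((x i : ℝ) ^ (-(1 + t))) := by
    refine (tsum_prod_fintype (fun (_ : Fin m) (n : ℕ) => (n : ℝ) ^ (-(1 + t)))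
      fun _ => ?_).1.of_norm
    exact (Real.summable_nat_rpow.2 (by linarith)).norm
  refine Summable.of_nonneg_of_le (fun n => (mzvTerm_pos _ n).le) (fun n => ?_)
    (hs.comp_injective Subtype.val_injective)
  obtain ⟨n, hn, hn0⟩ := n
  have hR : ∀ i, (1 : ℝ) ≤ n i := fun i => by exact_mod_cast hn0 i
  have hR0 : ∀ i, (0 : ℝ) < n i := fun i => zero_lt_one.trans_le (hR i)
  let z : Fin (k₀ :: ks).length := ⟨0, Nat.succ_pos _⟩
  have hle : ∀ i, (n i : ℝ) ≤ n z := fun i => by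
    exact_mod_cast hn.antitone (Fin.le_def.2 (Nat.zero_le _))
  simp only [mzvTerm, Function.comp]
  calc ∏ i, 1 / (n i : ℝ) ^ (k₀ :: ks).get i
      ≤ ∏ i, (n i : ℝ)⁻¹ * (if i = z then (n z : ℝ)⁻¹ else 1) := by
        refine Finset.prod_le_prod (fun i _ => by positivity) fun i _ => ?_
        rw [one_div]
        split_ifs with hi
        · subst hi
          rw [← mul_inv, ← sq]
          exact inv_anti₀ (pow_pos (hR0 z) 2) (pow_le_pow_right₀ (hR z) h2)
        · rw [mul_one]
          refine inv_anti₀ (hR0 i) (le_self_pow₀ (hR i) ?_)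
          have := hpos _ (List.get_mem (k₀ :: ks) i)
          omega
    _ = (∏ i, (n i : ℝ)⁻¹) * ∏ _i : Fin (k₀ :: ks).length, (n z : ℝ) ^ (-t) := by
        rw [Finset.prod_mul_distrib, Finset.prod_ite_eq' Finset.univ z,
          if_pos (Finset.mem_univ _), Finset.prod_const, Finset.card_univ, Fintype.card_fin,
          ← Real.rpow_natCast, ← Real.rpow_mul (hR0 z).le]
        have : -t * ((k₀ :: ks).length : ℝ) = -1 := by
          rw [ht, List.length_cons, ← hm, neg_mul, one_div_mul_cancel hm0.ne']
        rw [this, Real.rpow_neg_one]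
    _ ≤ ∏ i, (n i : ℝ) ^ (-(1 + t)) := by
        rw [← Finset.prod_mul_distrib]
        refine Finset.prod_le_prod (fun i _ => by have := hR0 i; have := hR0 z; positivity)
          fun i _ => ?_
        rw [neg_add, Real.rpow_add (hR0 i), Real.rpow_neg_one]
        exact mul_le_mul_of_nonneg_left
          (Real.rpow_le_rpow_of_nonpos (hR0 i) (hle i) (by linarith)) (by have := hR0 i; positivity)

/-! ### From `[0, ∞]` back to finite values -/

theorem toReal_multiset_sum {s : Multiset ℝ≥0∞} (h : s.sum ≠ ⊤) :
    (∀ x ∈ s, x ≠ ⊤) ∧ s.sum.toReal = (s.map ENNReal.toReal).sum := by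
  induction s using Multiset.induction_on with
  | empty => simp
  | cons a s ih =>
    rw [Multiset.sum_cons, ENNReal.add_ne_top] at h
    refine ⟨fun x hx => ?_, ?_⟩
    · rcases Multiset.mem_cons.1 hx with rfl | hx
      exacts [h.1, (ih h.2).1 x hx]
    · rw [Multiset.sum_cons, ENNReal.toReal_add h.1 h.2, (ih h.2).2, Multiset.map_cons,
        Multiset.sum_cons]

theorem summable_expansion {d b c : List ℕ} (hb : PositiveIndex b)
    (hc : PositiveIndex c) (hb' : b ≠ []) (hc' : c ≠ []) (h : peacockSum (d ++ [0]) b c ≠ ⊤) :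
    (∀ s ∈ peacockExpansion d b c, Summable (mzvTerm s)) ∧
      (peacockSum (d ++ [0]) b c).toReal = ((peacockExpansion d b c).map mzv).sum := by
  rw [peacockSum_eq_sum_expansion hb hc hb' hc'] at h ⊢
  obtain ⟨h1, h2⟩ := toReal_multiset_sum h
  refine ⟨fun s hs => (summable_mzvTerm_iff s).2 (h1 _ (Multiset.mem_map_of_mem _ hs)), ?_⟩
  rw [h2, Multiset.map_map]
  simp only [Function.comp_def, mzv_eq]

theorem peacockSum_partial' (a b c : List ℕ) {b₁ c₁ : ℕ} (hb : 1 ≤ b₁) (hc : 1 ≤ c₁) :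
    peacockSum (a ++ [0]) (b₁ :: b) (c₁ :: c) =
      (∑ ν ∈ Finset.Icc 1 b₁, (b₁ + c₁ - ν - 1).choose (c₁ - 1) •
        peacockSum (a ++ [b₁ + c₁ - ν]) (ν :: b) (0 :: c)) +
      (∑ ν ∈ Finset.Icc 1 c₁, (b₁ + c₁ - ν - 1).choose (b₁ - 1) •
        peacockSum (a ++ [b₁ + c₁ - ν]) (0 :: b) (ν :: c)) := by
  obtain ⟨q, rfl⟩ := Nat.exists_eq_add_of_le' hb
  obtain ⟨p, rfl⟩ := Nat.exists_eq_add_of_le' hc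
  rw [Nat.add_sub_cancel, Nat.add_sub_cancel,
    sum_Icc_choose_eq_pascalSum (fun k ν => peacockSum (a ++ [k]) (ν :: b) (0 :: c)) (by ring),
    sum_Icc_choose_eq_pascalSum (fun k ν => peacockSum (a ++ [k]) (0 :: b) (ν :: c)) (by ring),
    peacockSum_partial]

theorem nsmul_ne_top_iff {n : ℕ} (hn : n ≠ 0) {x : ℝ≥0∞} : n • x ≠ ⊤ ↔ x ≠ ⊤ := by
  rw [nsmul_eq_mul, Ne, ENNReal.mul_eq_top]
  simp [hn]

/-- The bound on `N` makes every binomial coefficient positive, so no infinite term can be hidden by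
a zero factor. -/
theorem sum_choose_ne_top_iff {p q N : ℕ} (h : p + q + 1 ≤ N) (f : ℕ → ℝ≥0∞) :
    ∑ ν ∈ Finset.Icc 1 q, (N - ν - 1).choose p • f ν ≠ ⊤ ↔ ∀ ν ∈ Finset.Icc 1 q, f ν ≠ ⊤ := by
  rw [ENNReal.sum_ne_top]
  refine forall₂_congr fun ν hν => nsmul_ne_top_iff ?_
  rw [Finset.mem_Icc] at hν
  exact (Nat.choose_pos (by omega)).ne'

theorem ofReal_toReal_sum_choose {s : Finset ℕ} {C : ℕ → ℕ} {f : ℕ → ℝ≥0∞} {g : ℕ → ℂ}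
    (h : ∀ ν ∈ s, f ν ≠ ⊤) (hg : ∀ ν ∈ s, g ν = ((f ν).toReal : ℂ)) :
    ((∑ ν ∈ s, C ν • f ν).toReal : ℂ) = ∑ ν ∈ s, (C ν : ℂ) * g ν := by
  rw [ENNReal.toReal_sum fun ν hν => by
    rw [nsmul_eq_mul]; exact ENNReal.mul_ne_top (ENNReal.natCast_ne_top _) (h ν hν)]
  push_cast
  refine Finset.sum_congr rfl fun ν hν => ?_
  rw [hg ν hν, nsmul_eq_mul, ENNReal.toReal_mul, ENNReal.toReal_natCast]
  push_cast
  rfl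

theorem mul_ne_top_iff_of_ne_zero {x y : ℝ≥0∞} (hx : x ≠ 0) (hy : y ≠ 0) :
    x * y ≠ ⊤ ↔ x ≠ ⊤ ∧ y ≠ ⊤ := by
  rw [Ne, ENNReal.mul_eq_top]
  tauto

theorem AdmissibleIndex.ne_nil {k : List ℕ} (hk : AdmissibleIndex k) : k ≠ [] := by
  rintro rfl
  exact absurd hk.2 (by simp)

theorem mainTheorem5 :
    -- interchange of the two feathers
    (∀ a b c : List ℕ, a ≠ [] → b ≠ [] → c ≠ [] →
      (PeacockConverges a b c ↔ PeacockConverges a c b) ∧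
      (PeacockConverges a b c → peacockZ a b c = peacockZ a c b)) ∧
    -- partial integration at the top vertex
    (∀ (a b c : List ℕ) (b₁ c₁ : ℕ), 1 ≤ b₁ → 1 ≤ c₁ →
      (PeacockConverges (a ++ [0]) (b₁ :: b) (c₁ :: c) ↔
        (∀ ν ∈ Finset.Icc 1 b₁, PeacockConverges (a ++ [b₁ + c₁ - ν]) (ν :: b) (0 :: c)) ∧
        (∀ ν ∈ Finset.Icc 1 c₁, PeacockConverges (a ++ [b₁ + c₁ - ν]) (0 :: b) (ν :: c))) ∧
      (PeacockConverges (a ++ [0]) (b₁ :: b) (c₁ :: c) →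
        peacockZ (a ++ [0]) (b₁ :: b) (c₁ :: c) =
          (∑ ν ∈ Finset.Icc 1 b₁, ((b₁ + c₁ - ν - 1).choose (c₁ - 1) : ℂ) *
            peacockZ (a ++ [b₁ + c₁ - ν]) (ν :: b) (0 :: c)) +
          (∑ ν ∈ Finset.Icc 1 c₁, ((b₁ + c₁ - ν - 1).choose (b₁ - 1) : ℂ) *
            peacockZ (a ++ [b₁ + c₁ - ν]) (0 :: b) (ν :: c)))) ∧
    -- exchange of propagators
    (∀ a b c : List ℕ, a ≠ [] → b ≠ [] → c ≠ [] →
      (PeacockConverges a (0 :: b) c ↔ PeacockConverges (a ++ [0]) b c) ∧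
      (PeacockConverges a c (0 :: b) ↔ PeacockConverges (a ++ [0]) b c) ∧
      (PeacockConverges (a ++ [0]) b c →
        peacockZ a (0 :: b) c = peacockZ a c (0 :: b) ∧
        peacockZ a c (0 :: b) = peacockZ (a ++ [0]) b c)) ∧
    -- the starting diagram is a product of two zeta values
    (∀ a b : List ℕ, a ≠ [] → b ≠ [] →
      (PeacockConverges [0] a b ↔ Summable (mzvTerm a) ∧ Summable (mzvTerm b)) ∧
      (PeacockConverges [0] a b → (mzv a : ℂ) * (mzv b : ℂ) = peacockZ [0] a b)) ∧
    -- the final diagrams are single zeta values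
    (∀ a b : List ℕ, a ≠ [] → b ≠ [] →
      (PeacockConverges a [0] b ↔ Summable (mzvTerm (a ++ b))) ∧
      (PeacockConverges a b [0] ↔ Summable (mzvTerm (a ++ b))) ∧
      (Summable (mzvTerm (a ++ b)) →
        peacockZ a [0] b = peacockZ a b [0] ∧ peacockZ a b [0] = (mzv (a ++ b) : ℂ))) ∧
    -- iteration of the two rules
    (∀ d b c : List ℕ, b ≠ [] → c ≠ [] → PositiveIndex b → PositiveIndex c →
      PeacockConverges (d ++ [0]) b c →
        (∀ s ∈ peacockExpansion d b c, Summable (mzvTerm s)) ∧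
        peacockZ (d ++ [0]) b c =
          ((peacockExpansion d b c).map fun s => (mzv s : ℂ)).sum) ∧
    -- the resulting expansion of a product of two convergent multiple zeta values
    (∀ a : List ℕ, AdmissibleIndex a → Summable (mzvTerm a)) ∧
    (∀ a b : List ℕ, AdmissibleIndex a → AdmissibleIndex b →
      (∀ s ∈ peacockExpansion [] a b,
        AdmissibleIndex s ∧ s.length = a.length + b.length ∧ s.sum = a.sum + b.sum) ∧
      mzv a * mzv b = ((peacockExpansion [] a b).map mzv).sum) ∧
    -- it is the shuffle product of the words that encode the two zeta values
    (∀ a b : List ℕ, PositiveIndex a → PositiveIndex b →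
      (peacockExpansion [] a b).map zetaWord = wordShuffle (zetaWord a) (zetaWord b)) := by
  have hc : ∀ (a : List ℕ) (k : ℕ), a ++ [k] ≠ [] := by simp
  refine ⟨?_, ?_, ?_, ?_, ?_, ?_, ?_, ?_, ?_⟩
  · intro a b c ha hb hc
    rw [peacockConverges_iff ha hb hc, peacockConverges_iff ha hc hb, peacockSum_comm a c b]
    refine ⟨Iff.rfl, fun h => ?_⟩
    rw [peacockZ_eq ha hb hc h, peacockSum_comm,
      peacockZ_eq ha hc hb (peacockSum_comm a b c ▸ h)]
  · intro a b c b₁ c₁ hb₁ hc₁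
    have hiff : peacockSum (a ++ [0]) (b₁ :: b) (c₁ :: c) ≠ ⊤ ↔
        (∀ ν ∈ Finset.Icc 1 b₁, peacockSum (a ++ [b₁ + c₁ - ν]) (ν :: b) (0 :: c) ≠ ⊤) ∧
        (∀ ν ∈ Finset.Icc 1 c₁, peacockSum (a ++ [b₁ + c₁ - ν]) (0 :: b) (ν :: c) ≠ ⊤) := by
      rw [peacockSum_partial' a b c hb₁ hc₁, ENNReal.add_ne_top,
        sum_choose_ne_top_iff (by omega), sum_choose_ne_top_iff (by omega)]
    simp only [peacockConverges_iff (hc _ _) (List.cons_ne_nil _ _) (List.cons_ne_nil _ _)]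
    refine ⟨hiff, fun h => ?_⟩
    obtain ⟨h1, h2⟩ := hiff.1 h
    rw [peacockZ_eq (hc _ _) (List.cons_ne_nil _ _) (List.cons_ne_nil _ _) h]
    rw [peacockSum_partial' a b c hb₁ hc₁] at h ⊢
    rw [ENNReal.add_ne_top] at h
    rw [ENNReal.toReal_add h.1 h.2, Complex.ofReal_add,
      ofReal_toReal_sum_choose h1 fun ν hν =>
        peacockZ_eq (hc _ _) (List.cons_ne_nil _ _) (List.cons_ne_nil _ _) (h1 ν hν),
      ofReal_toReal_sum_choose h2 fun ν hν =>
        peacockZ_eq (hc _ _) (List.cons_ne_nil _ _) (List.cons_ne_nil _ _) (h2 ν hν)]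
  · intro a b c ha hb hc'
    have h1 := peacockSum_zero_cons ha hb c
    have h2 := (peacockSum_comm a c (0 :: b)).trans h1
    rw [peacockConverges_iff ha (List.cons_ne_nil _ _) hc',
      peacockConverges_iff ha hc' (List.cons_ne_nil _ _), peacockConverges_iff (hc _ _) hb hc',
      h1, h2]
    refine ⟨Iff.rfl, Iff.rfl, fun h => ?_⟩
    rw [peacockZ_eq ha (List.cons_ne_nil _ _) hc' (h1 ▸ h),
      peacockZ_eq ha hc' (List.cons_ne_nil _ _) (h2 ▸ h), peacockZ_eq (hc _ _) hb hc' h, h1, h2]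
    exact ⟨rfl, rfl⟩
  · intro a b ha hb
    have h0 := List.cons_ne_nil 0 ([] : List ℕ)
    rw [peacockConverges_iff h0 ha hb, summable_mzvTerm_iff, summable_mzvTerm_iff]
    refine ⟨?_, fun h => ?_⟩
    · rw [peacockSum_zero_stem ha hb]
      exact mul_ne_top_iff_of_ne_zero (chainSum_one_ne_zero a) (chainSum_one_ne_zero b)
    · rw [peacockZ_eq h0 ha hb h, peacockSum_zero_stem ha hb, mzv_eq, mzv_eq, ENNReal.toReal_mul,
        Complex.ofReal_mul]
  · intro a b ha hb
    have h0 := List.cons_ne_nil 0 ([] : List ℕ)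
    have h1 := peacockSum_zero ha hb
    have h2 := (peacockSum_comm a b [0]).trans h1
    rw [peacockConverges_iff ha h0 hb, peacockConverges_iff ha hb h0, summable_mzvTerm_iff, h1, h2]
    refine ⟨Iff.rfl, Iff.rfl, fun h => ?_⟩
    rw [peacockZ_eq ha h0 hb (h1 ▸ h), peacockZ_eq ha hb h0 (h2 ▸ h), h1, h2, mzv_eq]
    exact ⟨rfl, rfl⟩
  · intro d b c hb' hc' hb hc'' h
    rw [peacockConverges_iff (hc _ _) hb' hc'] at h
    obtain ⟨h1, h2⟩ := summable_expansion hb hc'' hb' hc' h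
    refine ⟨h1, ?_⟩
    rw [peacockZ_eq (hc _ _) hb' hc' h, h2, ← Complex.ofRealHom_eq_coe, map_multiset_sum,
      Multiset.map_map]
    rfl
  · exact fun a ha => ha.summable_mzvTerm
  · intro a b ha hb
    constructor
    · intro s hs
      obtain ⟨t, rfl, ht, hl, hsum, h2⟩ := peacockExpansion_mem a b ha.1 hb.1 [] s hs
      exact ⟨⟨ht, h2 ha.2 hb.2⟩, hl, hsum⟩
    · have h := peacockSum_zero_stem ha.ne_nil hb.ne_nil
      -- The product is the diagram `(0|a|b)`, that is, the iteration started from the empty prefix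
      -- `d`.
      have hfin : peacockSum ([] ++ [0]) a b ≠ ⊤ := by
        rw [List.nil_append, h]
        exact ENNReal.mul_ne_top ((summable_mzvTerm_iff a).1 ha.summable_mzvTerm)
          ((summable_mzvTerm_iff b).1 hb.summable_mzvTerm)
      rw [← (summable_expansion ha.1 hb.1 ha.ne_nil hb.ne_nil hfin).2, List.nil_append, h,
        ENNReal.toReal_mul, mzv_eq, mzv_eq]
  · intro a b ha hb
    rw [map_zetaWord_peacockExpansion a b ha hb []]
    simp [zetaWord]
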